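/- **Field equations of non-local gravity.** Let $\Omega\subseteq\mathbb R^4$ be open (the image of a chart of spacetime, with time coordinate $t=x^0$), let $g$ be a smooth Lorentzian metric on $\Omega$, $\chi\neq0$ a real constant and $f:\mathbb R\to\mathbb R$ an analytic function. A variation of $g$ is a smooth symmetric tensor field $\delta g_{\mu\nu}=h_{\mu\nu}$ with compact support in $\Omega$, and $\delta$ denotes $\frac{d}{d\varepsilon}\big|_{\varepsilon=0}$ along $g+\varepsilon h$. For a metric with d'Alembertian $\Box=\frac1{\sqrt{-g}}\partial_\sigma(\sqrt{-g}\,g^{\sigma\lambda}\partial_\lambda)$ let $G(x,x')$ be its retarded Green function, i.e. the distributional kernel, mapping test functions to smooth functions on $\Omega$, with $\sqrt{-g(x)}\,\Box_xG(x,x')=\delta^4(x-x')$ and $G(x,x')=0$ for $t<t'$; for $p\in C_c^\infty(\Omega)$ put $$(\Box^{-1}p)(x)=\int_\Omega d^4x'\,\sqrt{-g(x')}\,G(x,x')\,p(x').$$ Assume that $\Box^{-1}$ exists and can be varied at $g$: for each variation $h$ the retarded Green function of $g+\varepsilon h$ exists for small $\varepsilon$ and depends on $\varepsilon$ in a $C^1$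 way (applied to a smooth family of test functions supported in a common compact subset of $\Omega$, it gives a $C^1$ function of $(\varepsilon,x)$). Assume also that the Ricci scalar $R$ of $g$ and the function $\Box^{-1}(Rf')$, where $f'=f'(\Box^{-1}R)$, have compact support in $\Omega$. Write $f=f(\Box^{-1}R)$, let $G_{\mu\nu}$ be the Einstein tensor and $$\Delta G_{\mu\nu}=(G_{\mu\nu}+g_{\mu\nu}\Box-\nabla_\mu\nabla_\nu)\bigl[f+\Box^{-1}(Rf')\bigr]+\Bigl(\delta^{(\sigma}_\mu\delta^{\lambda)}_\nu-\tfrac12 g_{\mu\nu}g^{\sigma\lambda}\Bigr)\partial_\sigma\Box^{-1}(Rf')\,\partial_\lambda\Box^{-1}R .$$ 1. (Vacuum.) The action $S_g=\frac1{2\chi}\int_\Omega d^4x\,\sqrt{-g}\,\bigl(R+Rf(\Box^{-1}R)\bigr)$ is stationary at $g$, i.e. $\delta S_g=0$ for all variations, if and only if $G_{\mu\nu}+\Delta G_{\mu\nu}=0$ on $\Omega$. 2. (Matter.) Let $S_m=\int_\Omega d^4x\,\sqrt{-g}\,\mathcal L_m$ be a matter action, integrable at $g+\varepsilon h$ for each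 variation $h$ and all small $\varepsilon$, and let its energy–momentum tensor at $g$ be $T_{\mu\nu}=-\frac{2}{\sqrt{-g}}\frac{\delta(\sqrt{-g}\mathcal L_m)}{\delta g^{\mu\nu}}$, i.e. $T$ is a continuous symmetric tensor field on $\Omega$ with $\delta S_m=-\frac12\int_\Omega d^4x\,\sqrt{-g}\,T_{\mu\nu}\,\delta g^{\mu\nu}$ for all variations. Then $S_g+S_m$ is stationary at $g$ if and only if $G_{\mu\nu}+\Delta G_{\mu\nu}=\chi T_{\mu\nu}$ on $\Omega$. -/

import Mathlib

open scoped ContDiff Distributions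
open TopologicalSpace

namespace NonlocalGravity

/-- Coordinate space `ℝ⁴`; the coordinate `x 0` is the time coordinate. -/
abbrev Pt : Type := Fin 4 → ℝ

/-- Components of a covariant two-tensor field in the chart. -/
abbrev Tensor2 : Type := Pt → Matrix (Fin 4) (Fin 4) ℝ

/-- Partial derivative `∂_μ φ`. -/
noncomputable def pd (μ : Fin 4) (φ : Pt → ℝ) (x : Pt) : ℝ :=
  fderiv ℝ φ x (Pi.single μ 1)

/-- A symmetric matrix of Lorentzian signature; both sign conventions `(-,+,+,+)` and
`(+,-,-,-)` are allowed. -/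
def IsLorentzian (A : Matrix (Fin 4) (Fin 4) ℝ) : Prop :=
  A.IsSymm ∧ ∃ P : Matrix (Fin 4) (Fin 4) ℝ, IsUnit P.det ∧
    (P.transpose * A * P = Matrix.diagonal ![-1, 1, 1, 1] ∨
      P.transpose * A * P = -Matrix.diagonal ![-1, 1, 1, 1])

/-- `g` is a smooth Lorentzian metric on the open set `Ω`. -/
def IsLorentzMetricOn (Ω : Opens Pt) (g : Tensor2) : Prop :=
  (∀ x ∈ Ω, IsLorentzian (g x)) ∧ ∀ μ ν, ContDiffOn ℝ ∞ (fun x => g x μ ν) Ω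

/-- `√(-g)`. -/
noncomputable def vol (g : Tensor2) (x : Pt) : ℝ := Real.sqrt (-(g x).det)

/-- `g^{μν}`. -/
noncomputable def ginv (g : Tensor2) (μ ν : Fin 4) (x : Pt) : ℝ := (g x)⁻¹ μ ν

/-- Christoffel symbols `Γ^k_{μν}`. -/
noncomputable def christoffel (g : Tensor2) (k μ ν : Fin 4) (x : Pt) : ℝ :=
  (1 / 2) * ∑ l, ginv g k l x *
    (pd μ (fun y => g y ν l) x + pd ν (fun y => g y μ l) x - pd l (fun y => g y μ ν) x)

/-- Ricci tensor `R_{μν} = ∂_k Γ^k_{μν} - ∂_ν Γ^k_{μk} + Γ^k_{kl} Γ^l_{μν} - Γ^k_{νl} Γ^l_{μk}`. -/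
noncomputable def ricci (g : Tensor2) (μ ν : Fin 4) (x : Pt) : ℝ :=
  (∑ k, pd k (christoffel g k μ ν) x) - (∑ k, pd ν (christoffel g k μ k) x)
    + (∑ k, ∑ l, christoffel g k k l x * christoffel g l μ ν x)
    - ∑ k, ∑ l, christoffel g k ν l x * christoffel g l μ k x

/-- Ricci scalar `R`. -/
noncomputable def scal (g : Tensor2) (x : Pt) : ℝ :=
  ∑ μ, ∑ ν, ginv g μ ν x * ricci g μ ν x

/-- Einstein tensor `G_{μν}`. -/
noncomputable def einstein (g : Tensor2) (μ ν : Fin 4) (x : Pt) : ℝ :=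
  ricci g μ ν x - (1 / 2) * g x μ ν * scal g x

/-- The d'Alembert operator `□φ = (1/√(-g)) ∂_σ(√(-g) g^{σλ} ∂_λ φ)`. -/
noncomputable def box (g : Tensor2) (φ : Pt → ℝ) (x : Pt) : ℝ :=
  (1 / vol g x) * ∑ σ, pd σ (fun y => ∑ l, vol g y * ginv g σ l y * pd l φ y) x

/-- The covariant Hessian `∇_μ ∇_ν φ` of a scalar. -/
noncomputable def hess (g : Tensor2) (μ ν : Fin 4) (φ : Pt → ℝ) (x : Pt) : ℝ :=
  pd μ (pd ν φ) x - ∑ k, christoffel g k μ ν x * pd k φ x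

/-- A kernel `G(x, x')` that is a distribution in `x'`, for each `x`. -/
abbrev Kernel (Ω : Opens Pt) : Type := Pt → 𝓓'(Ω, ℝ)

/-- `G` is a retarded Green function of `□` on `Ω`: the function `x ↦ ∫ G(x,x') φ(x') dx'` is smooth
for each test function `φ`, `√(-g(x)) □_x G(x,x') = δ(x - x')` (that is, `√(-g) □` takes this
function to `φ`), and `G(x,x') = 0` for `t < t'`. -/
structure IsRetardedGreen (Ω : Opens Pt) (g : Tensor2) (G : Kernel Ω) : Prop where
  smooth : ∀ φ : 𝓓(Ω, ℝ), ContDiffOn ℝ ∞ (fun x => G x φ) Ω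
  green : ∀ φ : 𝓓(Ω, ℝ), ∀ x ∈ Ω, vol g x * box g (fun y => G y φ) x = φ x
  retarded : ∀ φ : 𝓓(Ω, ℝ), ∀ x ∈ Ω, (∀ x' ∈ tsupport φ, x 0 < x' 0) → G x φ = 0

open Classical in
/-- A function on `Ω` that is smooth with compact support in `Ω`, extended by zero and regarded as
a test function (and `0` if it is not of this kind). -/
noncomputable def toTest (Ω : Opens Pt) (p : Pt → ℝ) : 𝓓(Ω, ℝ) :=
  if h : ContDiff ℝ ∞ ((Ω : Set Pt).indicator p) ∧
      HasCompactSupport ((Ω : Set Pt).indicator p) ∧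
      tsupport ((Ω : Set Pt).indicator p) ⊆ Ω then
    { toFun := (Ω : Set Pt).indicator p
      contDiff' := h.1
      hasCompactSupport' := h.2.1
      tsupport_subset' := h.2.2 }
  else 0

/-- `(□⁻¹ p)(x) = ∫_Ω √(-g(x')) G(x,x') p(x') dx'`. -/
noncomputable def boxInv (Ω : Opens Pt) (g : Tensor2) (G : Kernel Ω) (p : Pt → ℝ) (x : Pt) : ℝ :=
  G x (toTest Ω (fun y => vol g y * p y))

/-- `□⁻¹ R`. -/
noncomputable def potU (Ω : Opens Pt) (g : Tensor2) (G : Kernel Ω) : Pt → ℝ :=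
  boxInv Ω g G (scal g)

/-- `□⁻¹ (R f'(□⁻¹ R))`. -/
noncomputable def potV (Ω : Opens Pt) (f : ℝ → ℝ) (g : Tensor2) (G : Kernel Ω) : Pt → ℝ :=
  boxInv Ω g G (fun y => scal g y * deriv f (potU Ω g G y))

/-- The gravitational action `(1/2χ) ∫_Ω √(-g) (R + R f(□⁻¹ R))`; `Gr` assigns to a metric its
retarded Green function. -/
noncomputable def gravAction (Ω : Opens Pt) (χ : ℝ) (f : ℝ → ℝ) (Gr : Tensor2 → Kernel Ω)
    (g : Tensor2) : ℝ :=
  1 / (2 * χ) * ∫ x in (Ω : Set Pt),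
    vol g x * (scal g x + scal g x * f (potU Ω g (Gr g) x))

/-- The matter action `∫_Ω √(-g) L_m`, where `L_m` is the matter Lagrangian as a functional of the
metric (the matter fields being held fixed). -/
noncomputable def matterAction (Ω : Opens Pt) (Lm : Tensor2 → Pt → ℝ) (g : Tensor2) : ℝ :=
  ∫ x in (Ω : Set Pt), vol g x * Lm g x

/-- A variation `δg_{μν} = h_{μν}`: smooth, symmetric, with compact support in `Ω`. -/
def IsVariation (Ω : Opens Pt) (h : Tensor2) : Prop :=
  (∀ x, (h x).IsSymm) ∧ ∀ μ ν, ContDiff ℝ ∞ (fun x => h x μ ν) ∧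
    HasCompactSupport (fun x => h x μ ν) ∧ tsupport (fun x => h x μ ν) ⊆ (Ω : Set Pt)

/-- The varied metric `g + ε h`. -/
def vary (g h : Tensor2) (ε : ℝ) : Tensor2 := fun x => g x + ε • h x

/-- The variation `δg^{μν} = d/dε (g + ε h)^{μν}` at `ε = 0`. -/
noncomputable def deltaInv (g h : Tensor2) (μ ν : Fin 4) (x : Pt) : ℝ :=
  deriv (fun ε : ℝ => ginv (vary g h ε) μ ν x) 0

/-- `□⁻¹` can be varied along `g + ε h`: for small `ε` the metric `g + ε h` has the retarded Green
function `Gr (g + ε h)`, and it depends on `ε` in a `C¹` way, in the sense that for every smooth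
family of sources `φ_ε`, supported in a common compact subset of `Ω`, the function
`(ε, x) ↦ ∫ G_ε(x,x') φ_ε(x') dx'` is `C¹`. -/
def HasVariationAlong (Ω : Opens Pt) (Gr : Tensor2 → Kernel Ω) (g h : Tensor2) : Prop :=
  ∃ r : ℝ, 0 < r ∧
    (∀ ε ∈ Set.Ioo (-r) r, IsRetardedGreen Ω (vary g h ε) (Gr (vary g h ε))) ∧
    ∀ φ : ℝ → 𝓓(Ω, ℝ), ContDiff ℝ ∞ (fun q : ℝ × Pt => φ q.1 q.2) →
      (∃ K : Set Pt, IsCompact K ∧ K ⊆ Ω ∧ ∀ ε, tsupport (φ ε) ⊆ K) →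
      ContDiffOn ℝ 1 (fun q : ℝ × Pt => Gr (vary g h q.1) q.2 (φ q.1))
        (Set.Ioo (-r) r ×ˢ (Ω : Set Pt))

/-- The functional `S` is stationary at `g`: `δS = 0` for all variations of `g`. -/
def IsStationary (Ω : Opens Pt) (S : Tensor2 → ℝ) (g : Tensor2) : Prop :=
  ∀ h, IsVariation Ω h → HasDerivAt (fun ε : ℝ => S (vary g h ε)) 0 0

/-- `T_{μν} = -(2/√(-g)) δ(√(-g) L_m)/δg^{μν}` at the metric `g`: `T` is the continuous symmetric
tensor field on `Ω` with `δ ∫_Ω √(-g) L_m = -(1/2) ∫_Ω √(-g) T_{μν} δg^{μν}` for all variations. -/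
structure IsEnergyMomentum (Ω : Opens Pt) (Lm : Tensor2 → Pt → ℝ) (g T : Tensor2) : Prop where
  symm : ∀ x ∈ Ω, (T x).IsSymm
  cont : ∀ μ ν, ContinuousOn (fun x => T x μ ν) Ω
  integrable : ∀ h, IsVariation Ω h → ∀ᶠ ε in nhds (0 : ℝ),
    MeasureTheory.IntegrableOn (fun x => vol (vary g h ε) x * Lm (vary g h ε) x) Ω
  variation : ∀ h, IsVariation Ω h →
    HasDerivAt (fun ε : ℝ => matterAction Ω Lm (vary g h ε))
      (-(1 / 2) * ∫ x in (Ω : Set Pt), vol g x * ∑ μ, ∑ ν, T x μ ν * deltaInv g h μ ν x) 0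

/-- Kronecker delta. -/
def kron (μ ν : Fin 4) : ℝ := if μ = ν then 1 else 0

/-- The non-local correction
`ΔG_{μν} = (G_{μν} + g_{μν} □ - ∇_μ ∇_ν)[f(□⁻¹R) + □⁻¹(R f')]`
`+ (δ_μ^{(σ} δ_ν^{λ)} - (1/2) g_{μν} g^{σλ}) ∂_σ □⁻¹(R f') ∂_λ □⁻¹R`. -/
noncomputable def correction (Ω : Opens Pt) (f : ℝ → ℝ) (g : Tensor2) (G : Kernel Ω)
    (μ ν : Fin 4) (x : Pt) : ℝ :=
  let F : Pt → ℝ := fun y => f (potU Ω g G y) + potV Ω f g G y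
  (einstein g μ ν x * F x + g x μ ν * box g F x - hess g μ ν F x)
    + ∑ σ, ∑ l, ((1 / 2) * (kron μ σ * kron ν l + kron μ l * kron ν σ)
        - (1 / 2) * g x μ ν * ginv g σ l x)
        * pd σ (potV Ω f g G) x * pd l (potU Ω g G) x

/-- The function `p` on `Ω` has compact support in `Ω`. -/
def HasCompactSupportIn (Ω : Opens Pt) (p : Pt → ℝ) : Prop :=
  ∃ K : Set Pt, IsCompact K ∧ K ⊆ Ω ∧ ∀ x ∈ Ω, x ∉ K → p x = 0

end NonlocalGravity

/-! Write `U = □⁻¹R`, `V = □⁻¹(R f'(U))`, and let `δ` be the derivative at `ε = 0` along `g + εh`.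
The integrand of the action varies by `(1 + f(U)) δ(√(-g) R) + √(-g) R f'(U) δU`, and only the last
term is non-local. It is removed by an adjoint argument. With `V` held fixed, Green's identity for
the metric `g_ε = g + εh` gives `∫ V √(-g_ε) R_ε = ∫ V √(-g_ε) □_ε U_ε = ∫ U_ε √(-g_ε) □_ε V`, with
no boundary terms because `V` has compact support. Differentiating both ends and using `□V = R
f'(U)` at `ε = 0`, `∫ V δ(√(-g) R) = ∫ √(-g) R f'(U) δU + ∫ U δ(√(-g) □)V`, and a further
integration by parts turns the last integral into `-∫ δ(√(-g) g^{ij}) ∂_iU ∂_jV`. Hence `2χ δS_g = ∫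
(1 + f(U) + V) δ(√(-g) R) + ∫ δ(√(-g) g^{ij}) ∂_iU ∂_jV`. No `ε`-derivative is ever applied to `□_ε
U_ε`, so joint `C¹` dependence of `U_ε`, with smoothness in `x` for each `ε`, is enough.

For a weight `F`, the Palatini identity and integration by parts rewrite `∫ F δ(√(-g) R)` as the
pairing of `δg^{μν}` with `(G_{μν} + g_{μν}□ - ∇_μ∇_ν)F` (`mul_dd_vol_mul_scal`,
`integral_mul_dd_famDensity`). In `F = 1 + f(U) + V` the constant gives `G_{μν}` and the rest the
linear part of `ΔG_{μν}`; the second integral gives the quadratic part (`sum_kron_pairing`). These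
steps meet in `hasDerivAt_gravAction`. Since `δg⁻¹ = -g⁻¹ h g⁻¹` and `h` is free, the fundamental
lemma makes stationarity a pointwise equation.

The whole family `g + εh` is treated as a single matrix function on `ℝ × ℝ⁴`. There `δ` and `∂_μ`
are derivatives along constant directions, so they commute, and the geometric identities are proved
once for arbitrary directions. -/

namespace NonlocalGravity

/-! ### Calculus of derivatives along constant directions. -/

section DirectionalDerivative

variable {E : Type*} [NormedAddCommGroup E] [NormedSpace ℝ E]

/-- The derivative of `φ` at `x` in the direction `v`. -/
noncomputable def dd (v : E) (φ : E → ℝ) (x : E) : ℝ := fderiv ℝ φ x v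

variable {W : Set E} {φ ψ : E → ℝ} {x : E}

theorem ContDiffOn.differentiableAt_of_isOpen {n : ℕ∞ω} (hφ : ContDiffOn ℝ n φ W) (hW : IsOpen W)
    (hn : n ≠ 0) (hx : x ∈ W) : DifferentiableAt ℝ φ x :=
  (hφ.contDiffAt (hW.mem_nhds hx)).differentiableAt hn

theorem contDiffOn_dd (hW : IsOpen W) (hφ : ContDiffOn ℝ ∞ φ W) (v : E) :
    ContDiffOn ℝ ∞ (dd v φ) W :=
  (hφ.fderiv_of_isOpen hW (by simp)).clm_apply contDiffOn_const

theorem continuousOn_dd (hW : IsOpen W) (hφ : ContDiffOn ℝ 1 φ W) (v : E) :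
    ContinuousOn (dd v φ) W :=
  (hφ.continuousOn_fderiv_of_isOpen hW le_rfl).clm_apply continuousOn_const

theorem dd_congr (h : φ =ᶠ[nhds x] ψ) (v : E) : dd v φ x = dd v ψ x := by
  rw [dd, h.fderiv_eq, dd]

theorem dd_congr_of_eqOn (hW : IsOpen W) (h : Set.EqOn φ ψ W) (hx : x ∈ W) (v : E) :
    dd v φ x = dd v ψ x :=
  dd_congr (h.eventuallyEq_of_mem (hW.mem_nhds hx)) v

theorem dd_const (v : E) (c : ℝ) : dd v (fun _ => c) x = 0 := by simp [dd]

theorem dd_add (hφ : DifferentiableAt ℝ φ x) (hψ : DifferentiableAt ℝ ψ x) (v : E) :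
    dd v (fun y => φ y + ψ y) x = dd v φ x + dd v ψ x := by
  simp [dd, fderiv_fun_add hφ hψ]

theorem dd_sub (hφ : DifferentiableAt ℝ φ x) (hψ : DifferentiableAt ℝ ψ x) (v : E) :
    dd v (fun y => φ y - ψ y) x = dd v φ x - dd v ψ x := by
  simp [dd, fderiv_fun_sub hφ hψ]

theorem dd_neg (v : E) : dd v (fun y => -φ y) x = -dd v φ x := by
  simp [dd, fderiv_fun_neg]

theorem dd_mul (hφ : DifferentiableAt ℝ φ x) (hψ : DifferentiableAt ℝ ψ x) (v : E) :
    dd v (fun y => φ y * ψ y) x = dd v φ x * ψ x + φ x * dd v ψ x := by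
  simp [dd, fderiv_fun_mul hφ hψ]; ring

theorem dd_sum {ι : Type*} {s : Finset ι} {φ : ι → E → ℝ}
    (hφ : ∀ i ∈ s, DifferentiableAt ℝ (φ i) x) (v : E) :
    dd v (fun y => ∑ i ∈ s, φ i y) x = ∑ i ∈ s, dd v (φ i) x := by
  simp [dd, fderiv_fun_sum hφ]

theorem dd_comp {f : ℝ → ℝ} (hf : DifferentiableAt ℝ f (φ x)) (hφ : DifferentiableAt ℝ φ x)
    (v : E) : dd v (fun y => f (φ y)) x = deriv f (φ x) * dd v φ x := by
  have := (hf.hasDerivAt.comp_hasFDerivAt x hφ.hasFDerivAt).fderiv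
  rw [dd, show (fun y => f (φ y)) = f ∘ φ from rfl, this]
  simp [dd]

/-- Symmetry of the second derivative. With `v` the parameter direction and `w` a coordinate
direction this is the rule `δ∂_μ = ∂_μδ`. -/
theorem dd_comm (hW : IsOpen W) (hφ : ContDiffOn ℝ ∞ φ W) (hx : x ∈ W) (v w : E) :
    dd v (dd w φ) x = dd w (dd v φ) x := by
  have h2 : ContDiffAt ℝ ∞ φ x := hφ.contDiffAt (hW.mem_nhds hx)
  have hs : IsSymmSndFDerivAt ℝ φ x := h2.isSymmSndFDerivAt (by
    simpa using WithTop.coe_le_coe.2 (le_top : (2 : ℕ∞) ≤ ⊤))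
  have hd : DifferentiableAt ℝ (fderiv ℝ φ) x :=
    (h2.fderiv_right (m := ∞) (by simp)).differentiableAt (by simp)
  have key : ∀ u w : E, dd u (dd w φ) x = fderiv ℝ (fderiv ℝ φ) x u w := by
    intro u w
    have h := (hd.hasFDerivAt.clm_apply (hasFDerivAt_const w x)).fderiv
    rw [dd, show dd w φ = fun y => (fderiv ℝ φ y) w from rfl, h]
    simp
  rw [key, key, hs.eq]

end DirectionalDerivative

/-! ### Metric, Christoffel symbols and compatibility, relative to arbitrary directions. -/

section LocalGeometry

variable {E : Type*} [NormedAddCommGroup E] [NormedSpace ℝ E]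

/-- A smooth family of symmetric matrices with negative determinant on an open set. -/
structure SmoothMetric (W : Set E) (g : E → Matrix (Fin 4) (Fin 4) ℝ) : Prop where
  isOpen : IsOpen W
  symm : ∀ x ∈ W, (g x).IsSymm
  det_neg : ∀ x ∈ W, (g x).det < 0
  smooth : ∀ i j, ContDiffOn ℝ ∞ (fun x => g x i j) W

/-- The inverse metric. -/
noncomputable def invM (g : E → Matrix (Fin 4) (Fin 4) ℝ) (i j : Fin 4) (x : E) : ℝ := (g x)⁻¹ i j

/-- The density `√(-g)`. -/
noncomputable def volM (g : E → Matrix (Fin 4) (Fin 4) ℝ) (x : E) : ℝ := Real.sqrt (-(g x).det)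

/-- The density `√(-g) g^{ij}`. -/
noncomputable def densM (g : E → Matrix (Fin 4) (Fin 4) ℝ) (i j : Fin 4) (x : E) : ℝ :=
  volM g x * invM g i j x

/-- Christoffel symbols with respect to the directions `e`. -/
noncomputable def chr (e : Fin 4 → E) (g : E → Matrix (Fin 4) (Fin 4) ℝ) (k μ ν : Fin 4) (x : E) :
    ℝ :=
  (1 / 2) * ∑ l, invM g k l x *
    (dd (e μ) (fun y => g y ν l) x + dd (e ν) (fun y => g y μ l) x - dd (e l) (fun y => g y μ ν) x)

/-- Ricci tensor with respect to the directions `e`. -/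
noncomputable def ric (e : Fin 4 → E) (g : E → Matrix (Fin 4) (Fin 4) ℝ) (μ ν : Fin 4) (x : E) :
    ℝ :=
  (∑ k, dd (e k) (chr e g k μ ν) x) - (∑ k, dd (e ν) (chr e g k μ k) x)
    + (∑ k, ∑ l, chr e g k k l x * chr e g l μ ν x)
    - ∑ k, ∑ l, chr e g k ν l x * chr e g l μ k x

/-- Ricci scalar with respect to the directions `e`. -/
noncomputable def scalM (e : Fin 4 → E) (g : E → Matrix (Fin 4) (Fin 4) ℝ) (x : E) : ℝ :=
  ∑ μ, ∑ ν, invM g μ ν x * ric e g μ ν x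

variable {W : Set E} {g : E → Matrix (Fin 4) (Fin 4) ℝ} {x : E} {e : Fin 4 → E}

theorem contDiffOn_det_of_entries {A : E → Matrix (Fin 4) (Fin 4) ℝ} {n : ℕ∞ω}
    (hA : ∀ i j, ContDiffOn ℝ n (fun x => A x i j) W) : ContDiffOn ℝ n (fun x => (A x).det) W := by
  simp only [Matrix.det_apply']
  exact ContDiffOn.sum fun σ _ => contDiffOn_const.mul (contDiffOn_prod fun i _ => hA _ _)

namespace SmoothMetric

theorem diff (S : SmoothMetric W g) {φ : E → ℝ} (hφ : ContDiffOn ℝ ∞ φ W) (hx : x ∈ W) :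
    DifferentiableAt ℝ φ x :=
  ContDiffOn.differentiableAt_of_isOpen hφ S.isOpen (by simp) hx

theorem smooth_dd (S : SmoothMetric W g) {φ : E → ℝ} (hφ : ContDiffOn ℝ ∞ φ W) (v : E) :
    ContDiffOn ℝ ∞ (dd v φ) W :=
  contDiffOn_dd S.isOpen hφ v

theorem isUnit_det (S : SmoothMetric W g) (hx : x ∈ W) : IsUnit (g x).det :=
  (S.det_neg x hx).ne.isUnit

theorem smooth_det (S : SmoothMetric W g) : ContDiffOn ℝ ∞ (fun x => (g x).det) W :=
  contDiffOn_det_of_entries S.smooth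

theorem smooth_vol (S : SmoothMetric W g) : ContDiffOn ℝ ∞ (volM g) W :=
  S.smooth_det.neg.sqrt fun x hx => (neg_pos.2 (S.det_neg x hx)).ne'

theorem vol_pos (S : SmoothMetric W g) (hx : x ∈ W) : 0 < volM g x :=
  Real.sqrt_pos.2 (neg_pos.2 (S.det_neg x hx))

/-- The entries of the inverse are cofactors over the determinant, so everything reduces to
smoothness of determinants. -/
theorem smooth_inv (S : SmoothMetric W g) (i j : Fin 4) : ContDiffOn ℝ ∞ (invM g i j) W := by
  have h : invM g i j = fun x => ((g x).det)⁻¹ * ((g x).updateRow j (Pi.single i 1)).det := by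
    funext x
    simp [invM, Matrix.inv_def, Matrix.adjugate_apply]
  rw [h]
  refine (S.smooth_det.inv fun x hx => (S.det_neg x hx).ne).mul (contDiffOn_det_of_entries ?_)
  intro a b
  by_cases h : a = j
  · subst h; simpa using contDiffOn_const
  · simpa [Matrix.updateRow_ne h] using S.smooth a b

theorem smooth_dens (S : SmoothMetric W g) (i j : Fin 4) : ContDiffOn ℝ ∞ (densM g i j) W :=
  S.smooth_vol.mul (S.smooth_inv i j)

theorem smooth_chr (S : SmoothMetric W g) (k μ ν : Fin 4) : ContDiffOn ℝ ∞ (chr e g k μ ν) W :=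
  contDiffOn_const.mul (ContDiffOn.sum fun l _ => (S.smooth_inv k l).mul
    (((S.smooth_dd (S.smooth _ _) _).add (S.smooth_dd (S.smooth _ _) _)).sub
      (S.smooth_dd (S.smooth _ _) _)))

theorem smooth_ric (S : SmoothMetric W g) (μ ν : Fin 4) : ContDiffOn ℝ ∞ (ric e g μ ν) W :=
  (((ContDiffOn.sum fun _ _ => S.smooth_dd (S.smooth_chr _ _ _) _).sub
    (ContDiffOn.sum fun _ _ => S.smooth_dd (S.smooth_chr _ _ _) _)).add
    (ContDiffOn.sum fun _ _ => ContDiffOn.sum fun _ _ =>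
      (S.smooth_chr _ _ _).mul (S.smooth_chr _ _ _))).sub
    (ContDiffOn.sum fun _ _ => ContDiffOn.sum fun _ _ =>
      (S.smooth_chr _ _ _).mul (S.smooth_chr _ _ _))

theorem smooth_scal (S : SmoothMetric W g) : ContDiffOn ℝ ∞ (scalM e g) W :=
  ContDiffOn.sum fun _ _ => ContDiffOn.sum fun _ _ => (S.smooth_inv _ _).mul (S.smooth_ric _ _)

theorem g_symm (S : SmoothMetric W g) (hx : x ∈ W) (i j : Fin 4) : g x i j = g x j i :=
  (S.symm x hx).apply j i

theorem inv_symm (S : SmoothMetric W g) (hx : x ∈ W) (i j : Fin 4) :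
    invM g i j x = invM g j i x := by
  have h : ((g x)⁻¹).transpose = (g x)⁻¹ := by rw [Matrix.transpose_nonsing_inv, S.symm x hx]
  exact congrFun (congrFun h.symm i) j

theorem dens_symm (S : SmoothMetric W g) (hx : x ∈ W) (i j : Fin 4) :
    densM g i j x = densM g j i x := by
  rw [densM, densM, S.inv_symm hx]

theorem dd_symm (S : SmoothMetric W g) (hx : x ∈ W) (v : E) (i j : Fin 4) :
    dd v (fun y => g y i j) x = dd v (fun y => g y j i) x :=
  dd_congr_of_eqOn S.isOpen (fun _ hy => S.g_symm hy i j) hx v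

theorem dd_inv_symm (S : SmoothMetric W g) (hx : x ∈ W) (v : E) (i j : Fin 4) :
    dd v (invM g i j) x = dd v (invM g j i) x :=
  dd_congr_of_eqOn S.isOpen (fun _ hy => S.inv_symm hy i j) hx v

theorem chr_symm (S : SmoothMetric W g) (hx : x ∈ W) (k μ ν : Fin 4) :
    chr e g k μ ν x = chr e g k ν μ x := by
  unfold chr
  congr 1
  refine Finset.sum_congr rfl fun l _ => ?_
  rw [S.dd_symm hx (e l) μ ν]
  ring

theorem dd_chr_symm (S : SmoothMetric W g) (hx : x ∈ W) (v : E) (k μ ν : Fin 4) :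
    dd v (chr e g k μ ν) x = dd v (chr e g k ν μ) x :=
  dd_congr_of_eqOn S.isOpen (fun _ hy => S.chr_symm hy k μ ν) hx v

theorem sum_inv_mul (S : SmoothMetric W g) (hx : x ∈ W) (i j : Fin 4) :
    ∑ k, invM g i k x * g x k j = if i = j then 1 else 0 := by
  have h := congrFun (congrFun (Matrix.nonsing_inv_mul (g x) (S.isUnit_det hx)) i) j
  rwa [Matrix.mul_apply, Matrix.one_apply] at h

theorem sum_mul_inv (S : SmoothMetric W g) (hx : x ∈ W) (i j : Fin 4) :
    ∑ k, g x i k * invM g k j x = if i = j then 1 else 0 := by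
  have h := congrFun (congrFun (Matrix.mul_nonsing_inv (g x) (S.isUnit_det hx)) i) j
  rwa [Matrix.mul_apply, Matrix.one_apply] at h

/-- `∂ g⁻¹ = - g⁻¹ (∂ g) g⁻¹` as matrices. -/
theorem dd_inv_matrix (S : SmoothMetric W g) (hx : x ∈ W) (v : E) :
    Matrix.of (fun i j => dd v (invM g i j) x) =
      -((g x)⁻¹ * Matrix.of (fun i j => dd v (fun y => g y i j) x) * (g x)⁻¹) := by
  set D := Matrix.of (fun i j => dd v (fun y => g y i j) x) with hD
  set N := Matrix.of (fun i j => dd v (invM g i j) x) with hN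
  have h : N * g x + (g x)⁻¹ * D = 0 := by
    ext i j
    have h0 : dd v (fun y => ∑ k, invM g i k y * g y k j) x = 0 := by
      rw [dd_congr_of_eqOn S.isOpen (ψ := fun _ => if i = j then 1 else 0)
        (fun y hy => S.sum_inv_mul hy i j) hx, dd_const]
    rw [dd_sum (φ := fun k y => invM g i k y * g y k j) fun k _ =>
      (S.diff (S.smooth_inv i k) hx).mul (S.diff (S.smooth k j) hx)] at h0
    rw [Matrix.add_apply, Matrix.mul_apply, Matrix.mul_apply, ← Finset.sum_add_distrib,
      Matrix.zero_apply, ← h0]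
    refine Finset.sum_congr rfl fun k _ => ?_
    rw [dd_mul (S.diff (S.smooth_inv i k) hx) (S.diff (S.smooth k j) hx)]
    rfl
  have h1 : N = N * g x * (g x)⁻¹ := by
    rw [Matrix.mul_assoc, Matrix.mul_nonsing_inv _ (S.isUnit_det hx), Matrix.mul_one]
  rw [h1, eq_neg_of_add_eq_zero_left h, Matrix.neg_mul]

/-- **Jacobi's formula** for the derivative of a determinant. -/
theorem dd_det (S : SmoothMetric W g) (hx : x ∈ W) (v : E) :
    dd v (fun y => (g y).det) x =
      (g x).det * ∑ i, ∑ j, invM g i j x * dd v (fun y => g y i j) x := by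
  have hmul : dd v (fun y => (g y).det) x =
      ∑ i, ((g x).updateRow i fun j => dd v (fun y => g y i j) x).det := by
    have hg : HasFDerivAt (fun y i j => g y i j)
        (ContinuousLinearMap.pi fun i => ContinuousLinearMap.pi fun j =>
          fderiv ℝ (fun y => g y i j) x) x :=
      hasFDerivAt_pi.2 fun i => hasFDerivAt_pi.2 fun j =>
        (S.diff (S.smooth i j) hx).hasFDerivAt
    -- The determinant is multilinear in the rows, so its derivative is the sum over rows of the
    -- determinants with that row differentiated; expanding along that row then produces the
    -- adjugate.
    let m : ContinuousMultilinearMap ℝ (fun _ : Fin 4 => Fin 4 → ℝ) ℝ :=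
      ⟨(Matrix.detRowAlternating (R := ℝ) (n := Fin 4)).toMultilinearMap, by
        exact Continuous.matrix_det (A := fun a : Fin 4 → Fin 4 → ℝ => Matrix.of a)
          (by fun_prop)⟩
    have h := ((m.hasFDerivAt (fun i j => g x i j)).comp x hg).fderiv
    have hm : (fun y => (g y).det) = (m ∘ fun y i j => g y i j) := rfl
    rw [dd, hm, h]
    simp only [ContinuousLinearMap.comp_apply, ContinuousMultilinearMap.linearDeriv_apply]
    rfl
  rw [hmul, Finset.mul_sum]
  refine Finset.sum_congr rfl fun i _ => ?_
  rw [← Matrix.cramer_transpose_apply, Matrix.cramer_eq_adjugate_mulVec, Matrix.mulVec, dotProduct,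
    Finset.mul_sum]
  refine Finset.sum_congr rfl fun j _ => ?_
  rw [S.inv_symm hx, ← mul_assoc]
  congr 1
  rw [invM, Matrix.inv_def, Matrix.smul_apply, Ring.inverse_eq_inv', smul_eq_mul,
    mul_inv_cancel_left₀ (S.det_neg x hx).ne, ← Matrix.adjugate_transpose, Matrix.transpose_apply]

theorem dd_vol (S : SmoothMetric W g) (hx : x ∈ W) (v : E) :
    dd v (volM g) x =
      (1 / 2) * volM g x * ∑ i, ∑ j, invM g i j x * dd v (fun y => g y i j) x := by
  have hd := S.det_neg x hx
  have h := dd_comp (f := Real.sqrt) (φ := fun y => -(g y).det) (x := x)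
    (Real.hasDerivAt_sqrt (neg_pos.2 hd).ne').differentiableAt
    (S.diff S.smooth_det hx).neg v
  rw [show volM g = fun y => Real.sqrt (-(g y).det) from rfl, h,
    (Real.hasDerivAt_sqrt (neg_pos.2 hd).ne').deriv, dd_neg, S.dd_det hx]
  have hs := S.vol_pos hx
  have h2 : (g x).det = -(volM g x * volM g x) := by
    rw [volM, Real.mul_self_sqrt (neg_pos.2 hd).le, neg_neg]
  change 1 / (2 * volM g x) * _ = 1 / 2 * volM g x * _
  rw [h2]
  field_simp

/-- Differentiating `g^{ij} g_{ij} = 4` shows that the traces `g^{ij} ∂g_{ij}` and `g_{ij} ∂g^{ij}`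
are opposite. This form is the useful one because the field equations are paired with `δg^{μν}`. -/
theorem dd_vol_inv (S : SmoothMetric W g) (hx : x ∈ W) (v : E) :
    dd v (volM g) x =
      -(1 / 2) * volM g x * ∑ i, ∑ j, g x i j * dd v (invM g i j) x := by
  have h4 : dd v (fun y => ∑ i, ∑ j, invM g i j y * g y i j) x = 0 := by
    rw [dd_congr_of_eqOn S.isOpen (ψ := fun _ => (4 : ℝ)) ?_ hx, dd_const]
    intro y hy
    have : ∀ i, ∑ j, invM g i j y * g y i j = 1 := by
      intro i
      rw [← (S.sum_inv_mul hy i i).trans (if_pos rfl)]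
      exact Finset.sum_congr rfl fun j _ => by rw [S.g_symm hy i j]
    simp [this]
  have hp : ∀ i j, DifferentiableAt ℝ (fun y => invM g i j y * g y i j) x := fun i j =>
    (S.diff (S.smooth_inv i j) hx).mul (S.diff (S.smooth i j) hx)
  rw [dd_sum fun i _ => DifferentiableAt.fun_sum fun j _ => hp i j] at h4
  simp_rw [dd_sum fun j (_ : j ∈ Finset.univ) => hp _ j,
    dd_mul (S.diff (S.smooth_inv _ _) hx) (S.diff (S.smooth _ _) hx),
    Finset.sum_add_distrib] at h4
  rw [S.dd_vol hx, eq_neg_of_add_eq_zero_right h4]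
  simp_rw [mul_comm (g x _ _)]
  ring

theorem sum_g_chr (S : SmoothMetric W g) (hx : x ∈ W) (i μ ν : Fin 4) :
    ∑ a, g x i a * chr e g a μ ν x = (1 / 2) * (dd (e μ) (fun y => g y ν i) x
      + dd (e ν) (fun y => g y μ i) x - dd (e i) (fun y => g y μ ν) x) := by
  set D : Fin 4 → ℝ := fun l => dd (e μ) (fun y => g y ν l) x
      + dd (e ν) (fun y => g y μ l) x - dd (e l) (fun y => g y μ ν) x with hD
  calc ∑ a, g x i a * chr e g a μ ν x
      = ∑ a, ∑ l, (1 / 2) * (g x i a * invM g a l x) * D l := by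
        refine Finset.sum_congr rfl fun a _ => ?_
        rw [chr, Finset.mul_sum, Finset.mul_sum]
        exact Finset.sum_congr rfl fun l _ => by simp only [hD]; ring
    _ = ∑ l, (1 / 2) * (∑ a, g x i a * invM g a l x) * D l := by
        rw [Finset.sum_comm]
        simp_rw [Finset.mul_sum, Finset.sum_mul]
    _ = (1 / 2) * D i := by simp [S.sum_mul_inv hx]

/-- Metric compatibility `∇g = 0`: in the sum of two Christoffel symbols of the first kind all but
one derivative cancel. -/
theorem dd_metric (S : SmoothMetric W g) (hx : x ∈ W) (i j k : Fin 4) :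
    dd (e k) (fun y => g y i j) x =
      ∑ a, g x i a * chr e g a k j x + ∑ a, g x j a * chr e g a k i x := by
  rw [S.sum_g_chr hx, S.sum_g_chr hx, S.dd_symm hx (e k) j i, S.dd_symm hx (e j) k i,
    S.dd_symm hx (e i) k j]
  ring

/-- In matrix form compatibility reads `∂g = gΓ + (gΓ)ᵀ`; inserting this into `∂g⁻¹ = -g⁻¹(∂g)g⁻¹`
gives `∇g⁻¹ = 0`. -/
theorem dd_inv (S : SmoothMetric W g) (hx : x ∈ W) (i j k : Fin 4) :
    dd (e k) (invM g i j) x =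
      -∑ l, chr e g i k l x * invM g l j x - ∑ l, chr e g j k l x * invM g l i x := by
  set G : Matrix (Fin 4) (Fin 4) ℝ := Matrix.of fun a l => chr e g a k l x with hG
  have hD : Matrix.of (fun i j => dd (e k) (fun y => g y i j) x) = g x * G + (g x * G).transpose := by
    ext i j
    simp only [Matrix.of_apply, Matrix.add_apply, Matrix.transpose_apply, Matrix.mul_apply, hG]
    exact S.dd_metric hx i j k
  have hN := S.dd_inv_matrix hx (e k)
  have hsymm : ((g x)⁻¹).transpose = (g x)⁻¹ := by rw [Matrix.transpose_nonsing_inv, S.symm x hx]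
  have hN2 : (g x)⁻¹ * (g x * G + (g x * G).transpose) * (g x)⁻¹ =
      G * (g x)⁻¹ + (G * (g x)⁻¹).transpose := by
    rw [Matrix.mul_add, Matrix.add_mul, ← Matrix.mul_assoc (g x)⁻¹ (g x),
      Matrix.nonsing_inv_mul _ (S.isUnit_det hx), Matrix.one_mul, Matrix.transpose_mul,
      Matrix.transpose_mul, hsymm, S.symm x hx, Matrix.mul_assoc, Matrix.mul_assoc,
      Matrix.mul_nonsing_inv _ (S.isUnit_det hx), Matrix.mul_one]
  rw [hD, hN2] at hN
  have h := congrFun (congrFun hN i) j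
  simp only [Matrix.of_apply, Matrix.neg_apply, Matrix.add_apply, Matrix.transpose_apply,
    Matrix.mul_apply, hG] at h
  rw [h, neg_add]
  rfl

/-- In the trace, the two derivative terms exchanged by `k ↔ l` cancel, and what remains is Jacobi's
formula. -/
theorem sum_chr_trace (S : SmoothMetric W g) (hx : x ∈ W) (μ : Fin 4) :
    dd (e μ) (volM g) x = volM g x * ∑ k, chr e g k μ k x := by
  have h : ∑ k, chr e g k μ k x =
      (1 / 2) * ∑ i, ∑ j, invM g i j x * dd (e μ) (fun y => g y i j) x := by
    have h1 : ∑ k, ∑ l, invM g k l x * dd (e k) (fun y => g y μ l) x =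
        ∑ k, ∑ l, invM g k l x * dd (e l) (fun y => g y μ k) x := by
      rw [Finset.sum_comm]
      exact Finset.sum_congr rfl fun k _ => Finset.sum_congr rfl fun l _ => by
        rw [S.inv_symm hx]
    simp_rw [chr, mul_sub, mul_add, Finset.sum_sub_distrib, Finset.sum_add_distrib]
    rw [← Finset.mul_sum, Finset.sum_sub_distrib, Finset.sum_add_distrib, h1]
    ring
  rw [h, S.dd_vol hx]
  ring

/-- Covariant constancy of the density `√(-g) g⁻¹`, combining the trace formula with `∇g⁻¹ = 0`. It
is the compatibility hypothesis of `palatini_algebra`. -/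
theorem dd_dens (S : SmoothMetric W g) (hx : x ∈ W) (k i j : Fin 4) :
    dd (e k) (densM g i j) x =
      (∑ l, chr e g l k l x) * densM g i j x - ∑ l, chr e g i k l x * densM g l j x
        - ∑ l, chr e g j k l x * densM g l i x := by
  have h0 : dd (e k) (densM g i j) x =
      dd (e k) (volM g) x * invM g i j x + volM g x * dd (e k) (invM g i j) x :=
    dd_mul (S.diff S.smooth_vol hx) (S.diff (S.smooth_inv i j) hx) _
  rw [h0, S.sum_chr_trace hx, S.dd_inv hx]
  have h : ∀ a b : Fin 4, ∑ l, chr e g a k l x * densM g l b x =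
      volM g x * ∑ l, chr e g a k l x * invM g l b x := by
    intro a b
    rw [Finset.mul_sum]
    exact Finset.sum_congr rfl fun l _ => by rw [densM]; ring
  rw [h, h, densM]
  ring

/-- The contracted Christoffel symbols are the divergence of `√(-g) g⁻¹`. -/
theorem sum_dd_dens (S : SmoothMetric W g) (hx : x ∈ W) (j : Fin 4) :
    ∑ i, dd (e i) (densM g i j) x = -∑ μ, ∑ ν, densM g μ ν x * chr e g j μ ν x := by
  have h0 : ∀ i, dd (e i) (densM g i j) x = _ := fun i => S.dd_dens hx i i j
  simp only [h0, Finset.sum_sub_distrib, Finset.sum_mul]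
  have h1 : ∑ i, ∑ l, chr e g i i l x * densM g l j x =
      ∑ i, ∑ l, chr e g l i l x * densM g i j x := by
    rw [Finset.sum_comm]
    exact Finset.sum_congr rfl fun i _ => Finset.sum_congr rfl fun l _ => by
      rw [S.chr_symm hx]
  have h2 : ∑ i, ∑ l, chr e g j i l x * densM g l i x =
      ∑ μ, ∑ ν, densM g μ ν x * chr e g j μ ν x :=
    Finset.sum_congr rfl fun i _ => Finset.sum_congr rfl fun l _ => by
      rw [S.dens_symm hx, mul_comm]
  linarith

end SmoothMetric

end LocalGeometry

/-! ### Index algebra behind the Palatini identity. -/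

section PalatiniAlgebra

variable {ι : Type*} [Fintype ι]

/-- Renaming of summation indices: `σ` permutes the four indices, and giving its inverse `τ`
explicitly makes both inverse laws hold by `rfl`. -/
theorem sum_reindex₄ {f f' : ι → ι → ι → ι → ℝ} (σ τ : ι × ι × ι × ι → ι × ι × ι × ι)
    (hl : ∀ p, τ (σ p) = p) (hr : ∀ p, σ (τ p) = p)
    (h : ∀ a b c d, f a b c d = f' (σ (a, b, c, d)).1 (σ (a, b, c, d)).2.1
      (σ (a, b, c, d)).2.2.1 (σ (a, b, c, d)).2.2.2) :
    ∑ a, ∑ b, ∑ c, ∑ d, f a b c d = ∑ a, ∑ b, ∑ c, ∑ d, f' a b c d := by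
  have hs : ∀ f : ι → ι → ι → ι → ℝ, ∑ a, ∑ b, ∑ c, ∑ d, f a b c d =
      ∑ p : ι × ι × ι × ι, f p.1 p.2.1 p.2.2.1 p.2.2.2 := by
    intro f
    simp only [Fintype.sum_prod_type]
  rw [hs, hs]
  exact Fintype.sum_equiv ⟨σ, τ, hl, hr⟩ _ _ fun p => h _ _ _ _

/-- The terms without derivatives in the Palatini identity cancel when the density `a` is
compatible with the connection `Γ`. -/
theorem palatini_algebra {a : ι → ι → ℝ} {Γ C da : ι → ι → ι → ℝ} (ha : ∀ i j, a i j = a j i)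
    (hΓ : ∀ k i j, Γ k i j = Γ k j i) (hC : ∀ k i j, C k i j = C k j i)
    (hda : ∀ k i j, da k i j =
      (∑ l, Γ l k l) * a i j - ∑ l, Γ i k l * a l j - ∑ l, Γ j k l * a l i) :
    ∑ μ, ∑ ν, a μ ν * ((∑ k, ∑ l, (C k k l * Γ l μ ν + Γ k k l * C l μ ν))
        - ∑ k, ∑ l, (C k ν l * Γ l μ k + Γ k ν l * C l μ k)) =
      ∑ k, ∑ μ, ∑ ν, da k μ ν * C k μ ν - ∑ ν, ∑ μ, ∑ k, da ν μ ν * C k μ k := by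
  have h1 : ∑ μ, ∑ ν, ∑ k, ∑ l, a μ ν * (C k k l * Γ l μ ν) =
      ∑ ν, ∑ μ, ∑ k, ∑ l, Γ μ ν l * a l ν * C k μ k :=
    sum_reindex₄ (fun p => (p.2.1, p.2.2.2, p.2.2.1, p.1)) (fun p => (p.2.2.2, p.1, p.2.2.1, p.2.1))
      (fun _ => rfl) (fun _ => rfl) fun μ ν k l => by
        dsimp only
        rw [hC k k l, hΓ l μ ν]; ring
  have h2 : ∑ μ, ∑ ν, ∑ k, ∑ l, a μ ν * (Γ k k l * C l μ ν) =
      ∑ k, ∑ μ, ∑ ν, ∑ l, Γ l k l * a μ ν * C k μ ν :=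
    sum_reindex₄ (fun p => (p.2.2.2, p.1, p.2.1, p.2.2.1)) (fun p => (p.2.1, p.2.2.1, p.2.2.2, p.1))
      (fun _ => rfl) (fun _ => rfl) fun μ ν k l => by
        dsimp only
        rw [hΓ k k l]; ring
  have h3 : ∑ μ, ∑ ν, ∑ k, ∑ l, a μ ν * (C k ν l * Γ l μ k) =
      ∑ k, ∑ μ, ∑ ν, ∑ l, Γ μ k l * a l ν * C k μ ν :=
    sum_reindex₄ (fun p => (p.2.2.1, p.2.2.2, p.2.1, p.1)) (fun p => (p.2.2.2, p.2.2.1, p.1, p.2.1))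
      (fun _ => rfl) (fun _ => rfl) fun μ ν k l => by
        dsimp only
        rw [hΓ l μ k, hC k ν l]; ring
  have h4 : ∑ μ, ∑ ν, ∑ k, ∑ l, a μ ν * (Γ k ν l * C l μ k) =
      ∑ k, ∑ μ, ∑ ν, ∑ l, Γ ν k l * a l μ * C k μ ν :=
    sum_reindex₄ (fun p => (p.2.2.2, p.1, p.2.2.1, p.2.1)) (fun p => (p.2.1, p.2.2.2, p.2.2.1, p.1))
      (fun _ => rfl) (fun _ => rfl) fun μ ν k l => by
        dsimp only
        rw [hΓ k ν l, ha μ ν]; ring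
  -- In the contracted derivative `da ν μ ν` the two terms containing a trace of `Γ` cancel; the
  -- third is matched by `h1`.
  have h5 : ∑ ν, ∑ μ, ∑ k, ∑ l, Γ l ν l * a μ ν * C k μ k =
      ∑ ν, ∑ μ, ∑ k, ∑ l, Γ ν ν l * a l μ * C k μ k :=
    sum_reindex₄ (fun p => (p.2.2.2, p.2.1, p.2.2.1, p.1)) (fun p => (p.2.2.2, p.2.1, p.2.2.1, p.1))
      (fun _ => rfl) (fun _ => rfl) fun ν μ k l => by
        dsimp only
        rw [hΓ l ν l, ha μ ν]
  simp only [hda, mul_sub, sub_mul, mul_add, Finset.mul_sum, Finset.sum_mul,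
    Finset.sum_add_distrib, Finset.sum_sub_distrib]
  linarith

end PalatiniAlgebra

/-! ### Variation of `√(-g) R`, with and without a weight, up to divergences. -/

section LocalGeometry

variable {E : Type*} [NormedAddCommGroup E] [NormedSpace ℝ E]

theorem dd_sum_mul {ι : Type*} [Fintype ι] {p q : ι → E → ℝ} {x : E}
    (hp : ∀ i, DifferentiableAt ℝ (p i) x) (hq : ∀ i, DifferentiableAt ℝ (q i) x) (v : E) :
    dd v (fun y => ∑ i, p i y * q i y) x =
      ∑ i, (dd v (p i) x * q i x + p i x * dd v (q i) x) := by
  rw [dd_sum (φ := fun l y => p l y * q l y) fun l _ => (hp l).mul (hq l)]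
  exact Finset.sum_congr rfl fun l _ => dd_mul (hp l) (hq l) v

theorem dd_sum_sum_mul {ι : Type*} [Fintype ι] {p q : ι → ι → E → ℝ} {x : E}
    (hp : ∀ i j, DifferentiableAt ℝ (p i j) x) (hq : ∀ i j, DifferentiableAt ℝ (q i j) x) (v : E) :
    dd v (fun y => ∑ i, ∑ j, p i j y * q i j y) x =
      ∑ i, ∑ j, (dd v (p i j) x * q i j x + p i j x * dd v (q i j) x) := by
  rw [dd_sum (φ := fun k y => ∑ l, p k l y * q k l y)
    fun k _ => DifferentiableAt.fun_sum fun l _ => (hp k l).mul (hq k l)]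
  exact Finset.sum_congr rfl fun k _ => dd_sum_mul (hp k) (hq k) v

/-- The d'Alembert operator with respect to the directions `e`. -/
noncomputable def boxM (e : Fin 4 → E) (g : E → Matrix (Fin 4) (Fin 4) ℝ) (F : E → ℝ) (x : E) : ℝ :=
  (1 / volM g x) * ∑ σ, dd (e σ) (fun y => ∑ l, volM g y * invM g σ l y * dd (e l) F y) x

/-- The covariant Hessian with respect to the directions `e`. -/
noncomputable def hessM (e : Fin 4 → E) (g : E → Matrix (Fin 4) (Fin 4) ℝ) (μ ν : Fin 4)
    (F : E → ℝ) (x : E) : ℝ :=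
  dd (e μ) (dd (e ν) F) x - ∑ k, chr e g k μ ν x * dd (e k) F x

/-- The vector density whose divergence is `√(-g) g^{μν} δR_{μν}`. -/
noncomputable def palatiniField (e : Fin 4 → E) (τ : E) (g : E → Matrix (Fin 4) (Fin 4) ℝ)
    (k : Fin 4) (x : E) : ℝ :=
  (∑ μ, ∑ ν, densM g μ ν x * dd τ (chr e g k μ ν) x)
    - ∑ μ, ∑ l, densM g μ k x * dd τ (chr e g l μ l) x

/-- The part of the boundary field of the variation of `∫ F √(-g) R` that involves `∂F`. -/
noncomputable def gradField (e : Fin 4 → E) (τ : E) (g : E → Matrix (Fin 4) (Fin 4) ℝ)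
    (F : E → ℝ) (k : Fin 4) (x : E) : ℝ :=
  (∑ l, dd τ (densM g k l) x * dd (e l) F x)
    + dd τ (fun y => Real.log (volM g y)) x * ∑ l, densM g k l x * dd (e l) F x

variable {W : Set E} {g : E → Matrix (Fin 4) (Fin 4) ℝ} {x : E} {e : Fin 4 → E} {F : E → ℝ}

namespace SmoothMetric

theorem dd_ric (S : SmoothMetric W g) (hx : x ∈ W) (τ : E) (μ ν : Fin 4) :
    dd τ (ric e g μ ν) x =
      (∑ k, dd (e k) (dd τ (chr e g k μ ν)) x) - (∑ k, dd (e ν) (dd τ (chr e g k μ k)) x)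
      + ((∑ k, ∑ l, (dd τ (chr e g k k l) x * chr e g l μ ν x
          + chr e g k k l x * dd τ (chr e g l μ ν) x))
        - ∑ k, ∑ l, (dd τ (chr e g k ν l) x * chr e g l μ k x
          + chr e g k ν l x * dd τ (chr e g l μ k) x)) := by
  have hc : ∀ k i j, DifferentiableAt ℝ (chr e g k i j) x := fun k i j =>
    S.diff (S.smooth_chr k i j) hx
  have hdc : ∀ v k i j, DifferentiableAt ℝ (dd v (chr e g k i j)) x := fun v k i j =>
    S.diff (S.smooth_dd (S.smooth_chr k i j) v) hx
  have hA : DifferentiableAt ℝ (fun y => ∑ k, dd (e k) (chr e g k μ ν) y) x :=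
    DifferentiableAt.fun_sum fun k _ => hdc _ _ _ _
  have hB : DifferentiableAt ℝ (fun y => ∑ k, dd (e ν) (chr e g k μ k) y) x :=
    DifferentiableAt.fun_sum fun k _ => hdc _ _ _ _
  have hP : DifferentiableAt ℝ (fun y => ∑ k, ∑ l, chr e g k k l y * chr e g l μ ν y) x :=
    DifferentiableAt.fun_sum fun k _ => DifferentiableAt.fun_sum fun l _ => (hc _ _ _).mul (hc _ _ _)
  have hQ : DifferentiableAt ℝ (fun y => ∑ k, ∑ l, chr e g k ν l y * chr e g l μ k y) x :=
    DifferentiableAt.fun_sum fun k _ => DifferentiableAt.fun_sum fun l _ => (hc _ _ _).mul (hc _ _ _)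
  have h0 := dd_sub ((hA.sub hB).add hP) hQ τ
  have h1 := dd_add (hA.sub hB) hP τ
  have h2 := dd_sub hA hB τ
  have h3 := dd_sum (s := Finset.univ) (φ := fun k => dd (e k) (chr e g k μ ν)) (x := x)
    (fun k _ => hdc _ _ _ _) τ
  have h4 := dd_sum (s := Finset.univ) (φ := fun k => dd (e ν) (chr e g k μ k)) (x := x)
    (fun k _ => hdc _ _ _ _) τ
  have h5 := dd_sum_sum_mul (p := fun k l => chr e g k k l) (q := fun k l => chr e g l μ ν)
    (fun _ _ => hc _ _ _) (fun _ _ => hc _ _ _) τ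
  have h6 := dd_sum_sum_mul (p := fun k l => chr e g k ν l) (q := fun k l => chr e g l μ k)
    (fun _ _ => hc _ _ _) (fun _ _ => hc _ _ _) τ
  have h7 : ∀ k i j v, dd τ (dd v (chr e g k i j)) x = dd v (dd τ (chr e g k i j)) x :=
    fun k i j v => dd_comm S.isOpen (S.smooth_chr k i j) hx τ v
  simp only [h7] at h3 h4
  have h8 : dd τ (ric e g μ ν) x = _ := h0
  rw [h8, ← h3, ← h4, ← h5, ← h6]
  have h1' : dd τ (((fun y => ∑ k, dd (e k) (chr e g k μ ν) y) -
      fun y => ∑ k, dd (e ν) (chr e g k μ k) y) +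
      fun y => ∑ k, ∑ l, chr e g k k l y * chr e g l μ ν y) x = _ := h1
  have h2' : dd τ ((fun y => ∑ k, dd (e k) (chr e g k μ ν) y) -
      fun y => ∑ k, dd (e ν) (chr e g k μ k) y) x = _ := h2
  rw [h1', h2']
  ring

/-- The **Palatini identity**: `√(-g) g^{μν} δR_{μν}` is a divergence. -/
theorem palatini (S : SmoothMetric W g) (hx : x ∈ W) (τ : E) :
    ∑ μ, ∑ ν, densM g μ ν x * dd τ (ric e g μ ν) x =
      ∑ k, dd (e k) (palatiniField e τ g k) x := by
  have ha : ∀ i j, DifferentiableAt ℝ (densM g i j) x := fun i j => S.diff (S.smooth_dens i j) hx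
  have hC : ∀ k i j, DifferentiableAt ℝ (dd τ (chr e g k i j)) x := fun k i j =>
    S.diff (S.smooth_dd (S.smooth_chr k i j) τ) hx
  have hdiv : ∀ k, dd (e k) (palatiniField e τ g k) x =
      (∑ μ, ∑ ν, (dd (e k) (densM g μ ν) x * dd τ (chr e g k μ ν) x
        + densM g μ ν x * dd (e k) (dd τ (chr e g k μ ν)) x))
      - ∑ μ, ∑ l, (dd (e k) (densM g μ k) x * dd τ (chr e g l μ l) x
        + densM g μ k x * dd (e k) (dd τ (chr e g l μ l)) x) := by
    intro k
    have hd : ∀ p q : Fin 4 → Fin 4 → E → ℝ, (∀ k l, DifferentiableAt ℝ (p k l) x) →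
        (∀ k l, DifferentiableAt ℝ (q k l) x) →
        DifferentiableAt ℝ (fun y => ∑ a, ∑ b, p a b y * q a b y) x := fun p q hp hq =>
      DifferentiableAt.fun_sum fun k _ => DifferentiableAt.fun_sum fun l _ => (hp k l).mul (hq k l)
    have h3 := dd_sub
      (hd (fun μ ν => densM g μ ν) (fun μ ν => dd τ (chr e g k μ ν))
        (fun _ _ => ha _ _) (fun _ _ => hC _ _ _))
      (hd (fun μ l => densM g μ k) (fun μ l => dd τ (chr e g l μ l))
        (fun _ _ => ha _ _) (fun _ _ => hC _ _ _)) (e k)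
    rw [dd_sum_sum_mul (p := fun μ ν => densM g μ ν) (q := fun μ ν => dd τ (chr e g k μ ν))
        (fun _ _ => ha _ _) (fun _ _ => hC _ _ _),
      dd_sum_sum_mul (p := fun μ l => densM g μ k) (q := fun μ l => dd τ (chr e g l μ l))
        (fun _ _ => ha _ _) (fun _ _ => hC _ _ _)] at h3
    exact h3
  -- With `C = δΓ`, the `Γ δΓ` terms of `δR_{μν}` are exactly the terms of the divergence in which
  -- the outer derivative falls on the density.
  have halg := palatini_algebra (a := fun i j => densM g i j x) (Γ := fun k i j => chr e g k i j x)
    (C := fun k i j => dd τ (chr e g k i j) x) (da := fun k i j => dd (e k) (densM g i j) x)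
    (fun i j => S.dens_symm hx i j) (fun k i j => S.chr_symm hx k i j)
    (fun k i j => S.dd_chr_symm hx τ k i j) (fun k i j => S.dd_dens hx k i j)
  simp only [hdiv, S.dd_ric hx τ]
  have h1 : ∑ k, ∑ μ, ∑ ν, densM g μ ν x * dd (e k) (dd τ (chr e g k μ ν)) x =
      ∑ μ, ∑ ν, ∑ k, densM g μ ν x * dd (e k) (dd τ (chr e g k μ ν)) x := by
    rw [Finset.sum_comm]
    exact Finset.sum_congr rfl fun _ _ => Finset.sum_comm
  have h2 : ∑ ν, ∑ μ, ∑ k, densM g μ ν x * dd (e ν) (dd τ (chr e g k μ k)) x =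
      ∑ μ, ∑ ν, ∑ k, densM g μ ν x * dd (e ν) (dd τ (chr e g k μ k)) x := Finset.sum_comm
  have hsplit : ∀ P Q R : Fin 4 → Fin 4 → ℝ,
      ∑ μ, ∑ ν, densM g μ ν x * (P μ ν - Q μ ν + R μ ν) =
      ∑ μ, ∑ ν, densM g μ ν x * P μ ν - ∑ μ, ∑ ν, densM g μ ν x * Q μ ν
        + ∑ μ, ∑ ν, densM g μ ν x * R μ ν := by
    intro P Q R
    simp only [mul_add, mul_sub, Finset.sum_add_distrib, Finset.sum_sub_distrib]
  rw [hsplit, halg]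
  simp only [Finset.mul_sum, Finset.sum_add_distrib, Finset.sum_sub_distrib]
  linarith

theorem smooth_log_vol (S : SmoothMetric W g) :
    ContDiffOn ℝ ∞ (fun y => Real.log (volM g y)) W :=
  S.smooth_vol.log fun _ hx => (S.vol_pos hx).ne'

theorem dd_log_vol (S : SmoothMetric W g) (hx : x ∈ W) (v : E) :
    volM g x * dd v (fun y => Real.log (volM g y)) x = dd v (volM g) x := by
  have hv := (S.vol_pos hx).ne'
  rw [dd_comp (Real.differentiableAt_log hv) (S.diff S.smooth_vol hx), Real.deriv_log,
    mul_inv_cancel_left₀ hv]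

/-- The trace of the connection is a gradient. This gives the symmetry of the Ricci tensor and turns
the trace half of the Palatini field into a gradient of `δ log √(-g)`. -/
theorem chr_trace (S : SmoothMetric W g) (hx : x ∈ W) (μ : Fin 4) :
    ∑ k, chr e g k μ k x = dd (e μ) (fun y => Real.log (volM g y)) x := by
  have hv := (S.vol_pos hx).ne'
  have h := S.dd_log_vol hx (e μ)
  rw [S.sum_chr_trace hx] at h
  exact (mul_left_cancel₀ hv h).symm

theorem dd_chr_trace (S : SmoothMetric W g) (hx : x ∈ W) (v : E) (μ : Fin 4) :
    ∑ k, dd v (chr e g k μ k) x = dd (e μ) (dd v fun y => Real.log (volM g y)) x := by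
  rw [← dd_sum (φ := fun k => chr e g k μ k) fun k _ => S.diff (S.smooth_chr k μ k) hx,
    dd_comm S.isOpen S.smooth_log_vol hx]
  exact dd_congr_of_eqOn S.isOpen (fun y hy => S.chr_trace hy μ) hx v

/-- The one term whose symmetry is not algebraic is `∂_ν Γ^k_{μk}`, and it is a second derivative of
`log √(-g)`. -/
theorem ric_symm (S : SmoothMetric W g) (hx : x ∈ W) (μ ν : Fin 4) :
    ric e g μ ν x = ric e g ν μ x := by
  have h1 : ∑ k, dd (e k) (chr e g k μ ν) x = ∑ k, dd (e k) (chr e g k ν μ) x :=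
    Finset.sum_congr rfl fun k _ => S.dd_chr_symm hx _ _ _ _
  have h2 : ∑ k, dd (e ν) (chr e g k μ k) x = ∑ k, dd (e μ) (chr e g k ν k) x := by
    rw [S.dd_chr_trace hx, S.dd_chr_trace hx, dd_comm S.isOpen S.smooth_log_vol hx]
  have h3 : ∑ k, ∑ l, chr e g k k l x * chr e g l μ ν x =
      ∑ k, ∑ l, chr e g k k l x * chr e g l ν μ x :=
    Finset.sum_congr rfl fun k _ => Finset.sum_congr rfl fun l _ => by rw [S.chr_symm hx l]
  have h4 : ∑ k, ∑ l, chr e g k ν l x * chr e g l μ k x =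
      ∑ k, ∑ l, chr e g k μ l x * chr e g l ν k x := by
    rw [Finset.sum_comm]
    exact Finset.sum_congr rfl fun k _ => Finset.sum_congr rfl fun l _ => mul_comm _ _
  rw [ric, ric, h1, h2, h3, h4]

theorem vol_mul_boxM (S : SmoothMetric W g) (hx : x ∈ W) (F : E → ℝ) :
    volM g x * boxM e g F x =
      ∑ σ, dd (e σ) (fun y => ∑ l, densM g σ l y * dd (e l) F y) x := by
  rw [boxM, ← mul_assoc, mul_one_div_cancel (S.vol_pos hx).ne', one_mul]
  rfl

theorem smooth_boxM (S : SmoothMetric W g) (hF : ContDiffOn ℝ ∞ F W) :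
    ContDiffOn ℝ ∞ (boxM e g F) W :=
  (contDiffOn_const.div S.smooth_vol fun _ hx => (S.vol_pos hx).ne').mul
    (ContDiffOn.sum fun σ _ => S.smooth_dd (ContDiffOn.sum fun l _ =>
      (S.smooth_dens σ l).mul (S.smooth_dd hF _)) _)

theorem smooth_hessM (S : SmoothMetric W g) (hF : ContDiffOn ℝ ∞ F W) (μ ν : Fin 4) :
    ContDiffOn ℝ ∞ (hessM e g μ ν F) W :=
  (S.smooth_dd (S.smooth_dd hF _) _).sub
    (ContDiffOn.sum fun k _ => (S.smooth_chr k μ ν).mul (S.smooth_dd hF _))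

theorem hessM_symm (S : SmoothMetric W g) (hF : ContDiffOn ℝ ∞ F W) (hx : x ∈ W) (μ ν : Fin 4) :
    hessM e g μ ν F x = hessM e g ν μ F x := by
  simp only [hessM, dd_comm S.isOpen hF hx (e μ), S.chr_symm hx _ μ]

/-- The first-order part of `□` is the divergence of `√(-g) g⁻¹`, which `sum_dd_dens` identifies
with the Christoffel part of the Hessian. -/
theorem boxM_eq_trace (S : SmoothMetric W g) (hF : ContDiffOn ℝ ∞ F W) (hx : x ∈ W) :
    boxM e g F x = ∑ μ, ∑ ν, invM g μ ν x * hessM e g μ ν F x := by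
  have hdF : ∀ l, DifferentiableAt ℝ (dd (e l) F) x := fun l => S.diff (S.smooth_dd hF _) hx
  have ha : ∀ i j, DifferentiableAt ℝ (densM g i j) x := fun i j => S.diff (S.smooth_dens i j) hx
  refine mul_left_cancel₀ (S.vol_pos hx).ne' ?_
  rw [S.vol_mul_boxM hx]
  have h0 : ∀ σ, dd (e σ) (fun y => ∑ l, densM g σ l y * dd (e l) F y) x = _ := fun σ =>
    dd_sum_mul (p := fun l => densM g σ l) (q := fun l => dd (e l) F) (fun l => ha σ l) hdF (e σ)
  have h1 : ∑ σ, ∑ l, dd (e σ) (densM g σ l) x * dd (e l) F x =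
      -∑ μ, ∑ ν, densM g μ ν x * ∑ k, chr e g k μ ν x * dd (e k) F x := by
    have h2 : ∀ l, ∑ σ, dd (e σ) (densM g σ l) x * dd (e l) F x =
        -∑ μ, ∑ ν, densM g μ ν x * (chr e g l μ ν x * dd (e l) F x) := by
      intro l
      rw [← Finset.sum_mul, S.sum_dd_dens hx, neg_mul]
      simp only [Finset.sum_mul, mul_assoc]
    rw [Finset.sum_comm, Finset.sum_congr rfl fun l _ => h2 l, Finset.sum_neg_distrib]
    simp only [Finset.mul_sum]
    rw [Finset.sum_comm]
    exact congrArg _ (Finset.sum_congr rfl fun _ _ => Finset.sum_comm)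
  simp only [h0, Finset.sum_add_distrib, h1, hessM, mul_sub, Finset.sum_sub_distrib,
    Finset.mul_sum]
  simp only [densM, mul_assoc]
  ring

theorem dd_dens_eq (S : SmoothMetric W g) (hx : x ∈ W) (v : E) (i j : Fin 4) :
    dd v (densM g i j) x = volM g x * (dd v (fun y => Real.log (volM g y)) x * invM g i j x
      + dd v (invM g i j) x) := by
  have h0 : dd v (densM g i j) x = dd v (volM g) x * invM g i j x + volM g x * dd v (invM g i j) x :=
    dd_mul (S.diff S.smooth_vol hx) (S.diff (S.smooth_inv i j) hx) _
  rw [h0, ← S.dd_log_vol hx]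
  ring

theorem dd_log_vol_inv (S : SmoothMetric W g) (hx : x ∈ W) (v : E) :
    dd v (fun y => Real.log (volM g y)) x = -(1 / 2) * ∑ i, ∑ j, g x i j * dd v (invM g i j) x := by
  refine mul_left_cancel₀ (S.vol_pos hx).ne' ?_
  rw [S.dd_log_vol hx, S.dd_vol_inv hx]
  ring

/-- The variation of `√(-g) R`. -/
theorem dd_vol_mul_scal (S : SmoothMetric W g) (hx : x ∈ W) (τ : E) :
    dd τ (fun y => volM g y * scalM e g y) x =
      volM g x * ∑ μ, ∑ ν, dd τ (invM g μ ν) x *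
        (ric e g μ ν x - (1 / 2) * g x μ ν * scalM e g x)
      + ∑ k, dd (e k) (palatiniField e τ g k) x := by
  have h0 : (fun y => volM g y * scalM e g y) =
      fun y => ∑ μ, ∑ ν, densM g μ ν y * ric e g μ ν y := by
    funext y
    simp only [scalM, Finset.mul_sum, densM, mul_assoc]
  have h1 : dd τ (fun y => ∑ μ, ∑ ν, densM g μ ν y * ric e g μ ν y) x = _ :=
    dd_sum_sum_mul (p := densM g) (q := ric e g) (fun i j => S.diff (S.smooth_dens i j) hx)
      (fun i j => S.diff (S.smooth_ric i j) hx) τ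
  have h2 : ∑ μ, ∑ ν, dd τ (densM g μ ν) x * ric e g μ ν x =
      volM g x * (dd τ (fun y => Real.log (volM g y)) x * scalM e g x
        + ∑ μ, ∑ ν, dd τ (invM g μ ν) x * ric e g μ ν x) := by
    simp only [S.dd_dens_eq hx, scalM, Finset.mul_sum, mul_add, add_mul, Finset.sum_add_distrib,
      mul_assoc]
  have h3 : ∑ μ, ∑ ν, dd τ (invM g μ ν) x * (ric e g μ ν x - (1 / 2) * g x μ ν * scalM e g x) =
      ∑ μ, ∑ ν, dd τ (invM g μ ν) x * ric e g μ ν x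
        - (1 / 2) * scalM e g x * ∑ μ, ∑ ν, g x μ ν * dd τ (invM g μ ν) x := by
    simp only [mul_sub, Finset.sum_sub_distrib, Finset.mul_sum]
    congr 1
    exact Finset.sum_congr rfl fun _ _ => Finset.sum_congr rfl fun _ _ => by ring
  rw [h0, h1]
  simp only [Finset.sum_add_distrib]
  rw [S.palatini hx, h2, h3, S.dd_log_vol_inv hx]
  ring

theorem smooth_palatiniField (S : SmoothMetric W g) (τ : E) (k : Fin 4) :
    ContDiffOn ℝ ∞ (palatiniField e τ g k) W :=
  (ContDiffOn.sum fun _ _ => ContDiffOn.sum fun _ _ =>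
      (S.smooth_dens _ _).mul (S.smooth_dd (S.smooth_chr _ _ _) _)).sub
    (ContDiffOn.sum fun _ _ => ContDiffOn.sum fun _ _ =>
      (S.smooth_dens _ _).mul (S.smooth_dd (S.smooth_chr _ _ _) _))

theorem smooth_gradField (S : SmoothMetric W g) (hF : ContDiffOn ℝ ∞ F W) (τ : E) (k : Fin 4) :
    ContDiffOn ℝ ∞ (gradField e τ g F k) W :=
  (ContDiffOn.sum fun _ _ => (S.smooth_dd (S.smooth_dens _ _) _).mul (S.smooth_dd hF _)).add
    ((S.smooth_dd S.smooth_log_vol _).mul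
      (ContDiffOn.sum fun _ _ => (S.smooth_dens _ _).mul (S.smooth_dd hF _)))

/-- The product of the Palatini field with a gradient, up to a divergence. -/
theorem sum_palatiniField_mul (S : SmoothMetric W g) (hF : ContDiffOn ℝ ∞ F W) (hx : x ∈ W)
    (τ : E) :
    -∑ k, palatiniField e τ g k x * dd (e k) F x =
      volM g x * ∑ μ, ∑ ν, dd τ (invM g μ ν) x *
        (g x μ ν * boxM e g F x - hessM e g μ ν F x)
      + ∑ k, dd (e k) (gradField e τ g F k) x := by
  set L : E → ℝ := dd τ fun y => Real.log (volM g y) with hL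
  have hdF : ∀ l, DifferentiableAt ℝ (dd (e l) F) x := fun l => S.diff (S.smooth_dd hF _) hx
  have ha : ∀ i j, DifferentiableAt ℝ (densM g i j) x := fun i j => S.diff (S.smooth_dens i j) hx
  have hda : ∀ i j, DifferentiableAt ℝ (dd τ (densM g i j)) x := fun i j =>
    S.diff (S.smooth_dd (S.smooth_dens i j) τ) hx
  have hdL : DifferentiableAt ℝ L x := S.diff (S.smooth_dd S.smooth_log_vol τ) hx
  have hsum : ∀ k, DifferentiableAt ℝ (fun y => ∑ l, densM g k l y * dd (e l) F y) x := fun k =>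
    DifferentiableAt.fun_sum fun l _ => (ha k l).mul (hdF l)
  -- the divergence of the gradient field
  have hdiv : ∀ k, dd (e k) (gradField e τ g F k) x =
      (∑ l, (dd (e k) (dd τ (densM g k l)) x * dd (e l) F x
        + dd τ (densM g k l) x * dd (e k) (dd (e l) F) x))
      + (dd (e k) L x * ∑ l, densM g k l x * dd (e l) F x
        + L x * dd (e k) (fun y => ∑ l, densM g k l y * dd (e l) F y) x) := by
    intro k
    have h1 := dd_sum_mul (p := fun l => dd τ (densM g k l)) (q := fun l => dd (e l) F)
      (fun l => hda k l) hdF (e k)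
    have h2 := dd_mul hdL (hsum k) (e k)
    have h3 := dd_add (DifferentiableAt.fun_sum fun l (_ : l ∈ Finset.univ) =>
      (hda k l).mul (hdF l)) (hdL.mul (hsum k)) (e k)
    rw [← h1, ← h2]
    exact h3
  -- the variation of the divergence formula
  have hvar : ∀ l, ∑ k, dd (e k) (dd τ (densM g k l)) x =
      -∑ μ, ∑ ν, (dd τ (densM g μ ν) x * chr e g l μ ν x
        + densM g μ ν x * dd τ (chr e g l μ ν) x) := by
    intro l
    have h1 : dd τ (fun y => ∑ i, dd (e i) (densM g i l) y) x =
        dd τ (fun y => -∑ μ, ∑ ν, densM g μ ν y * chr e g l μ ν y) x :=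
      dd_congr_of_eqOn S.isOpen (fun y hy => S.sum_dd_dens hy l) hx τ
    rw [dd_neg, dd_sum_sum_mul (p := densM g) (q := chr e g l) ha
      (fun i j => S.diff (S.smooth_chr l i j) hx),
      dd_sum (φ := fun i => dd (e i) (densM g i l))
        (fun i _ => S.diff (S.smooth_dd (S.smooth_dens i l) _) hx)] at h1
    rw [← h1]
    exact Finset.sum_congr rfl fun k _ => dd_comm S.isOpen (S.smooth_dens k l) hx _ _
  have hvar' : ∑ k, ∑ l, dd (e k) (dd τ (densM g k l)) x * dd (e l) F x =
      -(∑ k, (∑ μ, ∑ ν, dd τ (densM g μ ν) x * chr e g k μ ν x) * dd (e k) F x)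
      - ∑ k, (∑ μ, ∑ ν, densM g μ ν x * dd τ (chr e g k μ ν) x) * dd (e k) F x := by
    rw [Finset.sum_comm, ← Finset.sum_neg_distrib, ← Finset.sum_sub_distrib]
    refine Finset.sum_congr rfl fun l _ => ?_
    rw [← Finset.sum_mul, hvar]
    simp only [Finset.sum_add_distrib]
    ring
  have hbox : ∑ k, dd (e k) (fun y => ∑ l, densM g k l y * dd (e l) F y) x =
      volM g x * boxM e g F x := (S.vol_mul_boxM hx F).symm
  -- The trace half of the Palatini field, contracted with `∂F`, cancels the term of the divergence
  -- of `gradField` in which `L` is differentiated.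
  have htr : ∑ k, (∑ μ, ∑ l, densM g μ k x * dd τ (chr e g l μ l) x) * dd (e k) F x =
      ∑ k, dd (e k) L x * ∑ l, densM g k l x * dd (e l) F x := by
    have h1 : ∀ k, ∑ μ, ∑ l, densM g μ k x * dd τ (chr e g l μ l) x =
        ∑ μ, densM g μ k x * dd (e μ) L x := fun k => Finset.sum_congr rfl fun μ _ => by
      rw [← Finset.mul_sum, S.dd_chr_trace hx]
    simp only [h1, Finset.sum_mul, Finset.mul_sum]
    rw [Finset.sum_comm]
    exact Finset.sum_congr rfl fun _ _ => Finset.sum_congr rfl fun _ _ => by ring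
  have hhess : ∑ k, ∑ l, dd τ (densM g k l) x * dd (e k) (dd (e l) F) x
      - ∑ k, (∑ μ, ∑ ν, dd τ (densM g μ ν) x * chr e g k μ ν x) * dd (e k) F x =
      ∑ μ, ∑ ν, dd τ (densM g μ ν) x * hessM e g μ ν F x := by
    simp only [hessM, mul_sub, Finset.sum_sub_distrib, Finset.mul_sum, Finset.sum_mul]
    congr 1
    rw [Finset.sum_comm]
    refine Finset.sum_congr rfl fun _ _ => ?_
    rw [Finset.sum_comm]
    exact Finset.sum_congr rfl fun _ _ => Finset.sum_congr rfl fun _ _ => by ring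
  have hdens : ∑ μ, ∑ ν, dd τ (densM g μ ν) x * hessM e g μ ν F x =
      volM g x * (L x * boxM e g F x + ∑ μ, ∑ ν, dd τ (invM g μ ν) x * hessM e g μ ν F x) := by
    rw [S.boxM_eq_trace hF hx]
    simp only [S.dd_dens_eq hx, ← hL, Finset.mul_sum, mul_add, add_mul, Finset.sum_add_distrib,
      mul_assoc]
  -- Here `g_{μν} δg^{μν} = -2L`. The two copies of `L □F` come from the divergence of `gradField`
  -- and from `hdens`.
  have hR : ∑ μ, ∑ ν, dd τ (invM g μ ν) x * (g x μ ν * boxM e g F x - hessM e g μ ν F x) =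
      (-2 * L x) * boxM e g F x - ∑ μ, ∑ ν, dd τ (invM g μ ν) x * hessM e g μ ν F x := by
    have h1 : -2 * L x = ∑ i, ∑ j, g x i j * dd τ (invM g i j) x := by
      rw [hL, S.dd_log_vol_inv hx]; ring
    rw [h1]
    simp only [mul_sub, Finset.sum_sub_distrib, Finset.sum_mul]
    congr 1
    exact Finset.sum_congr rfl fun _ _ => Finset.sum_congr rfl fun _ _ => by ring
  have hlhs : ∑ k, palatiniField e τ g k x * dd (e k) F x =
      ∑ k, (∑ μ, ∑ ν, densM g μ ν x * dd τ (chr e g k μ ν) x) * dd (e k) F x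
      - ∑ k, (∑ μ, ∑ l, densM g μ k x * dd τ (chr e g l μ l) x) * dd (e k) F x := by
    rw [← Finset.sum_sub_distrib]
    exact Finset.sum_congr rfl fun k _ => by rw [palatiniField, sub_mul]
  have hdivs : ∑ k, dd (e k) (gradField e τ g F k) x =
      ∑ k, ∑ l, dd (e k) (dd τ (densM g k l)) x * dd (e l) F x
      + ∑ k, ∑ l, dd τ (densM g k l) x * dd (e k) (dd (e l) F) x
      + ∑ k, dd (e k) L x * ∑ l, densM g k l x * dd (e l) F x
      + L x * (volM g x * boxM e g F x) := by
    rw [← hbox, Finset.mul_sum]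
    simp only [hdiv, Finset.sum_add_distrib]
    ring
  rw [hlhs, hdivs, hvar', htr, hR]
  linear_combination -hhess - hdens

/-- The variation of `√(-g) R`, multiplied by a function `F`, up to a divergence. -/
theorem mul_dd_vol_mul_scal (S : SmoothMetric W g) (hF : ContDiffOn ℝ ∞ F W) (hx : x ∈ W) (τ : E) :
    F x * dd τ (fun y => volM g y * scalM e g y) x =
      volM g x * ∑ μ, ∑ ν, dd τ (invM g μ ν) x *
        ((ric e g μ ν x - (1 / 2) * g x μ ν * scalM e g x) * F x
          + g x μ ν * boxM e g F x - hessM e g μ ν F x)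
      + ∑ k, dd (e k) (fun y => F y * palatiniField e τ g k y + gradField e τ g F k y) x := by
  have hP : ∀ k, DifferentiableAt ℝ (palatiniField e τ g k) x := fun k =>
    S.diff (S.smooth_palatiniField τ k) hx
  have hdF := S.diff hF hx
  have hdiv : ∀ k, dd (e k) (fun y => F y * palatiniField e τ g k y + gradField e τ g F k y) x =
      palatiniField e τ g k x * dd (e k) F x + F x * dd (e k) (palatiniField e τ g k) x
        + dd (e k) (gradField e τ g F k) x := by
    intro k
    rw [dd_add (φ := fun y => F y * palatiniField e τ g k y) (hdF.mul (hP k))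
      (S.diff (S.smooth_gradField hF τ k) hx), dd_mul hdF (hP k)]
    ring
  have hsplit : ∑ μ, ∑ ν, dd τ (invM g μ ν) x *
        ((ric e g μ ν x - (1 / 2) * g x μ ν * scalM e g x) * F x
          + g x μ ν * boxM e g F x - hessM e g μ ν F x) =
      (∑ μ, ∑ ν, dd τ (invM g μ ν) x * (ric e g μ ν x - (1 / 2) * g x μ ν * scalM e g x)) * F x
      + ∑ μ, ∑ ν, dd τ (invM g μ ν) x * (g x μ ν * boxM e g F x - hessM e g μ ν F x) := by
    simp only [Finset.sum_mul, ← Finset.sum_add_distrib]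
    exact Finset.sum_congr rfl fun _ _ => Finset.sum_congr rfl fun _ _ => by ring
  simp only [hdiv, Finset.sum_add_distrib, ← Finset.mul_sum]
  rw [hsplit, S.dd_vol_mul_scal hx]
  -- With `P` the Palatini field, `F ∂_k P^k = ∂_k(F P^k) - P^k ∂_k F`, and the last product is
  -- supplied by the preceding theorem.
  linear_combination S.sum_palatiniField_mul hF hx τ

end SmoothMetric

end LocalGeometry

/-! ### Integration by parts and differentiation under the integral. -/

section Integration

open MeasureTheory

/-- A point outside `U` is outside the closed set `C`, hence has a neighbourhood off `C`, on which
the extension by zero vanishes. -/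
theorem contDiff_indicator_of_eq_zero {E : Type*} [NormedAddCommGroup E] [NormedSpace ℝ E]
    {U C : Set E} {n : ℕ∞ω} {X : E → ℝ} (hU : IsOpen U) (hC : IsClosed C) (hCU : C ⊆ U)
    (hX : ContDiffOn ℝ n X U) (h0 : ∀ x ∈ U, x ∉ C → X x = 0) : ContDiff ℝ n (U.indicator X) := by
  rw [contDiff_iff_contDiffAt]
  intro x
  by_cases hx : x ∈ U
  · refine (hX.contDiffAt (hU.mem_nhds hx)).congr_of_eventuallyEq ?_
    filter_upwards [hU.mem_nhds hx] with y hy using Set.indicator_of_mem hy X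
  · refine (contDiffAt_const (c := (0 : ℝ))).congr_of_eventuallyEq ?_
    filter_upwards [hC.isOpen_compl.mem_nhds fun h => hx (hCU h)] with y hy
    by_cases hyU : y ∈ U
    · rw [Set.indicator_of_mem hyU, h0 y hyU hy]
    · exact Set.indicator_of_notMem hyU X

variable {Ω : Opens Pt} {K : Set Pt} {X : Pt → ℝ}

theorem tsupport_indicator_subset (hK : IsCompact K) (h0 : ∀ x ∈ Ω, x ∉ K → X x = 0) :
    tsupport ((Ω : Set Pt).indicator X) ⊆ K := by
  refine closure_minimal (fun x hx => ?_) hK.isClosed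
  by_contra hxK
  apply hx
  by_cases hxΩ : x ∈ (Ω : Set Pt)
  · rw [Set.indicator_of_mem hxΩ, h0 x hxΩ hxK]
  · exact Set.indicator_of_notMem hxΩ X

theorem integrableOn_of_eq_zero (hK : IsCompact K) (hKΩ : K ⊆ Ω) (hX : ContinuousOn X Ω)
    (h0 : ∀ x ∈ Ω, x ∉ K → X x = 0) : IntegrableOn X Ω :=
  ((hX.mono hKΩ).integrableOn_compact hK).of_forall_sdiff_eq_zero Ω.isOpen.measurableSet
    fun x hx => h0 x hx.1 hx.2

/-- The integral of a partial derivative of a compactly supported function vanishes. -/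
theorem integral_pd_eq_zero (hK : IsCompact K) (hKΩ : K ⊆ Ω) (hX : ContDiffOn ℝ 1 X Ω)
    (h0 : ∀ x ∈ Ω, x ∉ K → X x = 0) (σ : Fin 4) : ∫ x in (Ω : Set Pt), pd σ X x = 0 := by
  set Y := (Ω : Set Pt).indicator X with hY
  have hYs : ContDiff ℝ 1 Y :=
    contDiff_indicator_of_eq_zero Ω.isOpen hK.isClosed hKΩ hX h0
  have hYt : tsupport Y ⊆ K := tsupport_indicator_subset hK h0
  have hYc : HasCompactSupport Y := hK.of_isClosed_subset (isClosed_tsupport Y) hYt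
  have hdYc : HasCompactSupport (fun x => fderiv ℝ Y x (Pi.single σ 1)) :=
    hYc.fderiv_apply ℝ (Pi.single σ 1)
  have hdY : Continuous (fun x => fderiv ℝ Y x (Pi.single σ 1)) :=
    (hYs.continuous_fderiv (by simp)).clm_apply continuous_const
  have h1 : ∫ x in (Ω : Set Pt), pd σ X x = ∫ x in (Ω : Set Pt), fderiv ℝ Y x (Pi.single σ 1) := by
    refine setIntegral_congr_fun Ω.isOpen.measurableSet fun x hx => ?_
    have : X =ᶠ[nhds x] Y := by
      filter_upwards [Ω.isOpen.mem_nhds hx] with y hy using (Set.indicator_of_mem hy X).symm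
    simp only [pd, this.fderiv_eq]
  have h2 : ∫ x in (Ω : Set Pt), fderiv ℝ Y x (Pi.single σ 1) =
      ∫ x, fderiv ℝ Y x (Pi.single σ 1) := by
    refine setIntegral_eq_integral_of_forall_compl_eq_zero fun x hx => ?_
    have hx' : x ∉ tsupport Y := fun h => hx (hKΩ (hYt h))
    have : fderiv ℝ Y x = 0 := by
      by_contra hne
      exact hx' (support_fderiv_subset ℝ hne)
    rw [this]; rfl
  -- Integration by parts against the constant `1`.
  have h3 := integral_mul_fderiv_eq_neg_fderiv_mul_of_integrable (μ := (volume : Measure Pt))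
    (f := fun _ : Pt => (1 : ℝ)) (g := Y) (v := Pi.single σ 1) (by simp)
    (by simpa using hdY.integrable_of_hasCompactSupport hdYc)
    (by simpa using hYs.continuous.integrable_of_hasCompactSupport hYc)
    (fun _ _ => differentiableAt_const _) (fun x _ => hYs.differentiable (by simp) x)
  rw [h1, h2]
  simpa using h3

/-- The parameter direction in `ℝ × ℝ⁴`. -/
def paramDir : ℝ × Pt := (1, 0)

/-- The coordinate directions in `ℝ × ℝ⁴`. -/
def coordDir (μ : Fin 4) : ℝ × Pt := (0, Pi.single μ 1)

theorem hasDerivAt_slice {Φ : ℝ × Pt → ℝ} {ε : ℝ} {x : Pt} (hΦ : DifferentiableAt ℝ Φ (ε, x)) :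
    HasDerivAt (fun t => Φ (t, x)) (dd paramDir Φ (ε, x)) ε :=
  hΦ.hasFDerivAt.comp_hasDerivAt (f := fun t : ℝ => (t, x)) ε
    ((hasDerivAt_id ε).prodMk (hasDerivAt_const ε x))

theorem pd_slice {Φ : ℝ × Pt → ℝ} {ε : ℝ} {x : Pt} (hΦ : DifferentiableAt ℝ Φ (ε, x)) (μ : Fin 4) :
    pd μ (fun y => Φ (ε, y)) x = dd (coordDir μ) Φ (ε, x) := by
  have h := (hΦ.hasFDerivAt.comp (f := fun y : Pt => (ε, y)) x
    ((hasFDerivAt_const ε x).prodMk (hasFDerivAt_id x))).fderiv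
  rw [pd, show (fun y => Φ (ε, y)) = Φ ∘ fun y => (ε, y) from rfl, h]
  rfl

/-- Differentiation under the integral sign for `C¹` families with common compact support. -/
theorem hasDerivAt_integral_family {Ψ : ℝ × Pt → ℝ} {r : ℝ} (hr : 0 < r) (hK : IsCompact K)
    (hKΩ : K ⊆ Ω) (hΨ : ContDiffOn ℝ 1 Ψ (Set.Ioo (-r) r ×ˢ (Ω : Set Pt)))
    (h0 : ∀ ε ∈ Set.Ioo (-r) r, ∀ x ∈ Ω, x ∉ K → Ψ (ε, x) = 0) :
    HasDerivAt (fun ε => ∫ x in (Ω : Set Pt), Ψ (ε, x))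
      (∫ x in (Ω : Set Pt), dd paramDir Ψ (0, x)) 0 := by
  set U := Set.Ioo (-r) r ×ˢ (Ω : Set Pt) with hU
  have hUo : IsOpen U := isOpen_Ioo.prod Ω.isOpen
  have hdc : ContinuousOn (dd paramDir Ψ) U := continuousOn_dd hUo hΨ _
  have hslice : ∀ {Φ : ℝ × Pt → ℝ}, ContinuousOn Φ U → ∀ ε ∈ Set.Ioo (-r) r,
      ContinuousOn (fun x => Φ (ε, x)) (Ω : Set Pt) := fun hΦ ε hε =>
    hΦ.comp (by fun_prop) fun x hx => ⟨hε, hx⟩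
  have hd0 : ∀ ε ∈ Set.Ioo (-r) r, ∀ x ∈ Ω, x ∉ K → dd paramDir Ψ (ε, x) = 0 := by
    intro ε hε x hx hxK
    have : Ψ =ᶠ[nhds (ε, x)] fun _ => 0 := by
      have hV : IsOpen (Set.Ioo (-r) r ×ˢ ((Ω : Set Pt) ∩ Kᶜ)) :=
        isOpen_Ioo.prod (Ω.isOpen.inter hK.isClosed.isOpen_compl)
      filter_upwards [hV.mem_nhds ⟨hε, hx, hxK⟩] with q hq using h0 q.1 hq.1 q.2 hq.2.1 hq.2.2
    rw [dd_congr this, dd_const]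
  have hsub : Set.Icc (-(r / 2)) (r / 2) ⊆ Set.Ioo (-r) r := fun t ht =>
    ⟨by linarith [ht.1], by linarith [ht.2]⟩
  -- Shrinking to the closed parameter interval of radius `r / 2` makes the domain compact; `B` on
  -- `K` and zero elsewhere is the dominating function.
  obtain ⟨B, hB⟩ := (isCompact_Icc.prod hK).exists_bound_of_continuousOn
    (hdc.mono (Set.prod_mono hsub hKΩ))
  have hzero : (0 : ℝ) ∈ Set.Ioo (-r) r := ⟨by linarith, hr⟩
  refine (hasDerivAt_integral_of_dominated_loc_of_deriv_le (μ := volume.restrict (Ω : Set Pt))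
    (F := fun ε x => Ψ (ε, x)) (F' := fun ε x => dd paramDir Ψ (ε, x))
    (bound := K.indicator fun _ => B)
    (Icc_mem_nhds (a := -(r / 2)) (b := r / 2) (by linarith) (by linarith)) ?_ ?_ ?_ ?_ ?_ ?_).2
  · filter_upwards [Ioo_mem_nhds hzero.1 hzero.2] with ε hε
    exact (hslice hΨ.continuousOn ε hε).aestronglyMeasurable Ω.isOpen.measurableSet
  · exact integrableOn_of_eq_zero hK hKΩ (hslice hΨ.continuousOn 0 hzero) (h0 0 hzero)
  · exact (hslice hdc 0 hzero).aestronglyMeasurable Ω.isOpen.measurableSet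
  · filter_upwards [ae_restrict_mem Ω.isOpen.measurableSet] with x hx ε hε
    by_cases hxK : x ∈ K
    · rw [Set.indicator_of_mem hxK]
      exact hB (ε, x) ⟨hε, hxK⟩
    · rw [hd0 ε (hsub hε) x hx hxK, Set.indicator_of_notMem hxK, norm_zero]
  · refine Integrable.integrableOn ?_
    exact (integrable_indicator_iff hK.measurableSet).2 (integrableOn_const hK.measure_lt_top.ne)
  · filter_upwards [ae_restrict_mem Ω.isOpen.measurableSet] with x hx ε hε
    exact hasDerivAt_slice
      (ContDiffOn.differentiableAt_of_isOpen hΨ hUo (by simp) ⟨hsub hε, hx⟩)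

/-- **Green's identity** for a symmetric second-order operator in divergence form. -/
theorem integral_mul_div_grad_comm {a : Fin 4 → Fin 4 → Pt → ℝ} {u v : Pt → ℝ} (hK : IsCompact K)
    (hKΩ : K ⊆ Ω) (ha : ∀ i j, ContDiffOn ℝ ∞ (a i j) Ω)
    (hsymm : ∀ x ∈ Ω, ∀ i j, a i j x = a j i x) (hu : ContDiffOn ℝ ∞ u Ω)
    (hv : ContDiffOn ℝ ∞ v Ω) (hv0 : ∀ x ∈ Ω, x ∉ K → v x = 0) :
    ∫ x in (Ω : Set Pt), v x * ∑ i, pd i (fun y => ∑ j, a i j y * pd j u y) x =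
      ∫ x in (Ω : Set Pt), u x * ∑ i, pd i (fun y => ∑ j, a i j y * pd j v y) x := by
  have hpd : ∀ {φ : Pt → ℝ}, ContDiffOn ℝ ∞ φ Ω → ∀ i, ContDiffOn ℝ ∞ (pd i φ) Ω :=
    fun hφ i => contDiffOn_dd Ω.isOpen hφ _
  have hflux : ∀ {φ : Pt → ℝ}, ContDiffOn ℝ ∞ φ Ω → ∀ i,
      ContDiffOn ℝ ∞ (fun y => ∑ j, a i j y * pd j φ y) Ω := fun hφ i =>
    ContDiffOn.sum fun j _ => (ha i j).mul (hpd hφ j)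
  have hdiff : ∀ {φ : Pt → ℝ}, ContDiffOn ℝ ∞ φ Ω → ∀ x ∈ Ω, DifferentiableAt ℝ φ x :=
    fun hφ x hx => ContDiffOn.differentiableAt_of_isOpen hφ Ω.isOpen (by simp) hx
  have hpd0 : ∀ {φ : Pt → ℝ}, (∀ x ∈ Ω, x ∉ K → φ x = 0) → ∀ i, ∀ x ∈ Ω, x ∉ K → pd i φ x = 0 := by
    intro φ hφ i x hx hxK
    have : φ =ᶠ[nhds x] fun _ => 0 := by
      filter_upwards [(Ω.isOpen.inter hK.isClosed.isOpen_compl).mem_nhds ⟨hx, hxK⟩] with y hy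
        using hφ y hy.1 hy.2
    exact (dd_congr this _).trans (dd_const _ _)
  have hflux0 : ∀ i, ∀ x ∈ Ω, x ∉ K → ∑ j, a i j x * pd j v x = 0 := fun i x hx hxK =>
    Finset.sum_eq_zero fun j _ => by rw [hpd0 hv0 j x hx hxK, mul_zero]
  -- The divergence of the flux `v a∇u - u a∇v` is the difference of the integrands, the products of
  -- gradients cancelling by symmetry of `a`. Both of its terms vanish where `v` does, so `u` needs
  -- no support condition.
  let X : Fin 4 → Pt → ℝ := fun i y =>
    v y * (∑ j, a i j y * pd j u y) - u y * ∑ j, a i j y * pd j v y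
  have hX : ∀ i, ContDiffOn ℝ ∞ (X i) Ω := fun i => (hv.mul (hflux hu i)).sub (hu.mul (hflux hv i))
  have hX0 : ∀ i, ∀ x ∈ Ω, x ∉ K → X i x = 0 := fun i x hx hxK => by
    simp only [X, hv0 x hx hxK, hflux0 i x hx hxK, zero_mul, mul_zero, sub_zero]
  have hdiv : ∀ i, ∫ x in (Ω : Set Pt), pd i (X i) x = 0 := fun i =>
    integral_pd_eq_zero hK hKΩ ((hX i).of_le (by simp)) (hX0 i) i
  have hpt : ∀ x ∈ (Ω : Set Pt), v x * (∑ i, pd i (fun y => ∑ j, a i j y * pd j u y) x)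
      - u x * (∑ i, pd i (fun y => ∑ j, a i j y * pd j v y) x) = ∑ i, pd i (X i) x := by
    intro x hx
    have h1 : ∀ i, pd i (X i) x =
        pd i v x * (∑ j, a i j x * pd j u x) + v x * pd i (fun y => ∑ j, a i j y * pd j u y) x
        - (pd i u x * (∑ j, a i j x * pd j v x)
          + u x * pd i (fun y => ∑ j, a i j y * pd j v y) x) := by
      intro i
      have hA := dd_mul (hdiff hv x hx) (hdiff (hflux hu i) x hx) (Pi.single i 1)
      have hB := dd_mul (hdiff hu x hx) (hdiff (hflux hv i) x hx) (Pi.single i 1)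
      have hC := dd_sub ((hdiff hv x hx).mul (hdiff (hflux hu i) x hx))
        ((hdiff hu x hx).mul (hdiff (hflux hv i) x hx)) (Pi.single i 1)
      exact hC.trans (congrArg₂ _ hA hB)
    have h2 : ∑ i, pd i v x * (∑ j, a i j x * pd j u x) =
        ∑ i, pd i u x * (∑ j, a i j x * pd j v x) := by
      simp only [Finset.mul_sum]
      rw [Finset.sum_comm]
      exact Finset.sum_congr rfl fun i _ => Finset.sum_congr rfl fun j _ => by
        rw [hsymm x hx j i]; ring
    simp only [h1, Finset.sum_add_distrib, Finset.sum_sub_distrib, h2, ← Finset.mul_sum]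
    ring
  have hIu : IntegrableOn (fun x => v x * ∑ i, pd i (fun y => ∑ j, a i j y * pd j u y) x) Ω :=
    integrableOn_of_eq_zero hK hKΩ
      (hv.mul (ContDiffOn.sum fun i _ => hpd (hflux hu i) i)).continuousOn
      fun x hx hxK => by rw [hv0 x hx hxK, zero_mul]
  have hIv : IntegrableOn (fun x => u x * ∑ i, pd i (fun y => ∑ j, a i j y * pd j v y) x) Ω :=
    integrableOn_of_eq_zero hK hKΩ
      (hu.mul (ContDiffOn.sum fun i _ => hpd (hflux hv i) i)).continuousOn
      fun x hx hxK => by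
        rw [Finset.sum_eq_zero fun i _ => hpd0 (hflux0 i) i x hx hxK, mul_zero]
  rw [← sub_eq_zero, ← integral_sub hIu hIv, setIntegral_congr_fun Ω.isOpen.measurableSet hpt,
    integral_finsetSum _ fun i _ => ?_]
  · exact Finset.sum_eq_zero fun i _ => hdiv i
  · exact integrableOn_of_eq_zero hK hKΩ (hpd (hX i) i).continuousOn (hpd0 (hX0 i) i)

end Integration

/-! ### The family `g + εh` as one metric on a subset of `ℝ × ℝ⁴`. -/

section MetricFamily

/-- Congruence multiplies the determinant by a positive square, and in dimension four both signature
conventions have determinant `-1`. -/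
theorem IsLorentzian.det_neg {A : Matrix (Fin 4) (Fin 4) ℝ} (hA : IsLorentzian A) : A.det < 0 := by
  obtain ⟨-, P, hP, h⟩ := hA
  have hd : P.det * A.det * P.det = -1 := by
    have h1 : (P.transpose * A * P).det = P.det * A.det * P.det := by
      rw [Matrix.det_mul, Matrix.det_mul, Matrix.det_transpose]
    rw [← h1]
    rcases h with h | h <;> rw [h] <;> simp [Fin.prod_univ_four]
  have hp : 0 < P.det * P.det := mul_self_pos.2 hP.ne_zero
  by_contra hcon
  nlinarith [mul_nonneg hp.le (not_lt.1 hcon)]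

theorem IsLorentzMetricOn.smoothMetric {Ω : Opens Pt} {g : Tensor2} (hg : IsLorentzMetricOn Ω g) :
    SmoothMetric (Ω : Set Pt) g where
  isOpen := Ω.isOpen
  symm x hx := (hg.1 x hx).1
  det_neg x hx := (hg.1 x hx).det_neg
  smooth := hg.2

/-- The family of metrics `g + ε h`, as a function of `(ε, x)`. -/
def famMetric (g h : Tensor2) (q : ℝ × Pt) : Matrix (Fin 4) (Fin 4) ℝ := vary g h q.1 q.2

/-- The set of `(ε, x)` at which `g + ε h` has negative determinant. -/
def famDom (Ω : Opens Pt) (g h : Tensor2) : Set (ℝ × Pt) :=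
  {q | q.2 ∈ Ω ∧ (famMetric g h q).det < 0}

/-- The support of a variation. -/
def varSupport (h : Tensor2) : Set Pt := ⋃ i, ⋃ j, tsupport fun x => h x i j

variable {Ω : Opens Pt} {g h : Tensor2} {ε : ℝ} {x : Pt}

theorem vary_zero (g h : Tensor2) : vary g h 0 = g := by
  funext x
  simp [vary]

theorem isCompact_varSupport (hh : IsVariation Ω h) : IsCompact (varSupport h) :=
  isCompact_iUnion fun i => isCompact_iUnion fun j => (hh.2 i j).2.1

theorem varSupport_subset (hh : IsVariation Ω h) : varSupport h ⊆ Ω :=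
  Set.iUnion_subset fun i => Set.iUnion_subset fun j => (hh.2 i j).2.2

theorem vary_eventuallyEq (hh : IsVariation Ω h) (g : Tensor2) (ε : ℝ) (hx : x ∉ varSupport h) :
    vary g h ε =ᶠ[nhds x] g := by
  filter_upwards [(isCompact_varSupport hh).isClosed.isOpen_compl.mem_nhds hx] with y hy
  have h0 : h y = 0 := by
    ext i j
    by_contra hne
    exact hy (Set.mem_iUnion₂.2 ⟨i, j, subset_tsupport (fun x => h x i j) hne⟩)
  simp [vary, h0]

/-- Symmetry is linear in the metric and `det < 0` is an open condition, so the signature of `g +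
εh` need not be followed. -/
theorem smoothMetric_famMetric (hg : IsLorentzMetricOn Ω g) (hh : IsVariation Ω h) :
    SmoothMetric (famDom Ω g h) (famMetric g h) := by
  have hs : ∀ i j, ContDiffOn ℝ ∞ (fun q => famMetric g h q i j) {q : ℝ × Pt | q.2 ∈ Ω} := by
    intro i j
    have h1 : ContDiffOn ℝ ∞ (fun q : ℝ × Pt => g q.2 i j) {q : ℝ × Pt | q.2 ∈ Ω} :=
      (hg.2 i j).comp contDiff_snd.contDiffOn fun q hq => hq
    have h2 : ContDiff ℝ ∞ fun q : ℝ × Pt => q.1 * h q.2 i j :=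
      contDiff_fst.mul ((hh.2 i j).1.comp contDiff_snd)
    exact h1.add h2.contDiffOn
  refine ⟨?_, ?_, fun q hq => hq.2, fun i j => (hs i j).mono fun q hq => hq.1⟩
  · exact (contDiffOn_det_of_entries hs).continuousOn.isOpen_inter_preimage
      (Ω.isOpen.preimage continuous_snd) isOpen_Iio
  · intro q hq
    exact ((hg.1 q.2 hq.1).1).add ((hh.1 q.2).smul q.1)

theorem mem_famDom_zero (hg : IsLorentzMetricOn Ω g) (hx : x ∈ Ω) : ((0 : ℝ), x) ∈ famDom Ω g h := by
  refine ⟨hx, ?_⟩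
  change (vary g h 0 x).det < 0
  rw [vary_zero]
  exact (hg.1 x hx).det_neg

/-- A uniform radius exists although `Ω` is not compact: the tube lemma handles the compact support
of `h`, and elsewhere the metric is `g` itself. -/
theorem exists_radius_famDom (hg : IsLorentzMetricOn Ω g) (hh : IsVariation Ω h) :
    ∃ r : ℝ, 0 < r ∧ ∀ ε ∈ Set.Ioo (-r) r, ∀ x ∈ Ω, (ε, x) ∈ famDom Ω g h := by
  obtain ⟨u, v, hu, -, hu0, hv, huv⟩ := generalized_tube_lemma (isCompact_singleton (x := (0 : ℝ)))
    (isCompact_varSupport hh) (smoothMetric_famMetric hg hh).isOpen (by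
      rintro ⟨t, x⟩ ⟨ht, hx⟩
      obtain rfl : t = 0 := ht
      exact mem_famDom_zero hg (varSupport_subset hh hx))
  obtain ⟨r, hr, hru⟩ := Metric.mem_nhds_iff.1 (hu.mem_nhds (hu0 rfl))
  refine ⟨r, hr, fun ε hε x hx => ?_⟩
  by_cases hxs : x ∈ varSupport h
  · refine huv ⟨hru ?_, hv hxs⟩
    rw [Metric.mem_ball, Real.dist_eq, sub_zero]
    exact abs_lt.2 hε
  · refine ⟨hx, ?_⟩
    change (vary g h ε x).det < 0
    rw [(vary_eventuallyEq hh g ε hxs).eq_of_nhds]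
    exact (hg.1 x hx).det_neg

/-- The passage from chart derivatives at fixed `ε` to derivatives on `ℝ × ℝ⁴`. Agreement is asked
only on `D`, so the result can be iterated from the metric to `Γ` and on to the curvature. -/
theorem pd_eq_dd_coordDir {D : Set (ℝ × Pt)} (hD : IsOpen D) {Φ : ℝ × Pt → ℝ} {ψ : Pt → ℝ}
    (hΦ : ContDiffOn ℝ ∞ Φ D) (hψ : ∀ y, (ε, y) ∈ D → ψ y = Φ (ε, y)) (hx : (ε, x) ∈ D)
    (μ : Fin 4) : pd μ ψ x = dd (coordDir μ) Φ (ε, x) := by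
  rw [← pd_slice (ContDiffOn.differentiableAt_of_isOpen hΦ hD (by simp) hx)]
  refine dd_congr ?_ _
  filter_upwards [(hD.preimage (Continuous.prodMk_right ε)).mem_nhds hx] with y hy using hψ y hy

theorem christoffel_vary (hg : IsLorentzMetricOn Ω g) (hh : IsVariation Ω h)
    (hx : (ε, x) ∈ famDom Ω g h) (k μ ν : Fin 4) :
    christoffel (vary g h ε) k μ ν x = chr coordDir (famMetric g h) k μ ν (ε, x) := by
  have S := smoothMetric_famMetric hg hh
  have h1 : ∀ l i j, pd l (fun y => vary g h ε y i j) x =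
      dd (coordDir l) (fun q => famMetric g h q i j) (ε, x) := fun l i j =>
    pd_eq_dd_coordDir S.isOpen (S.smooth i j) (fun _ _ => rfl) hx l
  simp only [christoffel, chr, h1]
  rfl

theorem ricci_vary (hg : IsLorentzMetricOn Ω g) (hh : IsVariation Ω h)
    (hx : (ε, x) ∈ famDom Ω g h) (μ ν : Fin 4) :
    ricci (vary g h ε) μ ν x = ric coordDir (famMetric g h) μ ν (ε, x) := by
  have S := smoothMetric_famMetric hg hh
  have h1 : ∀ l k i j, pd l (christoffel (vary g h ε) k i j) x =
      dd (coordDir l) (chr coordDir (famMetric g h) k i j) (ε, x) := fun l k i j =>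
    pd_eq_dd_coordDir S.isOpen (S.smooth_chr k i j)
      (fun _ hy => christoffel_vary hg hh hy k i j) hx l
  simp only [ricci, ric, h1, christoffel_vary hg hh hx]

theorem scal_vary (hg : IsLorentzMetricOn Ω g) (hh : IsVariation Ω h)
    (hx : (ε, x) ∈ famDom Ω g h) :
    scal (vary g h ε) x = scalM coordDir (famMetric g h) (ε, x) := by
  simp only [scal, scalM, ricci_vary hg hh hx]
  rfl

theorem sum_pd_flux_vary (hg : IsLorentzMetricOn Ω g) (hh : IsVariation Ω h)
    (hx : (ε, x) ∈ famDom Ω g h) {F : Pt → ℝ} (hF : ContDiffOn ℝ ∞ F Ω) :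
    ∑ σ, pd σ (fun y => ∑ l, vol (vary g h ε) y * ginv (vary g h ε) σ l y * pd l F y) x =
      ∑ σ, dd (coordDir σ) (fun q => ∑ l, densM (famMetric g h) σ l q *
        dd (coordDir l) (fun q => F q.2) q) (ε, x) := by
  have S := smoothMetric_famMetric hg hh
  have hF' : ContDiffOn ℝ ∞ (fun q : ℝ × Pt => F q.2) (famDom Ω g h) :=
    hF.comp contDiff_snd.contDiffOn fun q hq => hq.1
  refine Finset.sum_congr rfl fun σ _ => pd_eq_dd_coordDir S.isOpen
    (ContDiffOn.sum fun l _ => (S.smooth_dens σ l).mul (S.smooth_dd hF' _)) (fun y hy => ?_) hx σ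
  refine Finset.sum_congr rfl fun l _ => ?_
  rw [← pd_eq_dd_coordDir S.isOpen hF' (fun _ _ => rfl) hy l]
  rfl

theorem box_vary (hg : IsLorentzMetricOn Ω g) (hh : IsVariation Ω h)
    (hx : (ε, x) ∈ famDom Ω g h) {F : Pt → ℝ} (hF : ContDiffOn ℝ ∞ F Ω) :
    box (vary g h ε) F x = boxM coordDir (famMetric g h) (fun q => F q.2) (ε, x) := by
  rw [box, sum_pd_flux_vary hg hh hx hF]
  rfl

theorem hess_vary (hg : IsLorentzMetricOn Ω g) (hh : IsVariation Ω h)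
    (hx : (ε, x) ∈ famDom Ω g h) {F : Pt → ℝ} (hF : ContDiffOn ℝ ∞ F Ω) (μ ν : Fin 4) :
    hess (vary g h ε) μ ν F x = hessM coordDir (famMetric g h) μ ν (fun q => F q.2) (ε, x) := by
  have S := smoothMetric_famMetric hg hh
  have hF' : ContDiffOn ℝ ∞ (fun q : ℝ × Pt => F q.2) (famDom Ω g h) :=
    hF.comp contDiff_snd.contDiffOn fun q hq => hq.1
  have h1 : ∀ l y, (ε, y) ∈ famDom Ω g h → pd l F y = dd (coordDir l) (fun q => F q.2) (ε, y) :=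
    fun l y hy => pd_eq_dd_coordDir S.isOpen hF' (fun _ _ => rfl) hy l
  rw [hess, hessM, pd_eq_dd_coordDir S.isOpen (S.smooth_dd hF' _) (h1 ν) hx μ]
  simp only [h1 _ x hx, christoffel_vary hg hh hx]

theorem deltaInv_eq_dd (hg : IsLorentzMetricOn Ω g) (hh : IsVariation Ω h) (hx : x ∈ Ω)
    (μ ν : Fin 4) : deltaInv g h μ ν x = dd paramDir (invM (famMetric g h) μ ν) (0, x) := by
  have S := smoothMetric_famMetric hg hh
  exact (hasDerivAt_slice (S.diff (S.smooth_inv μ ν) (mem_famDom_zero hg hx))).deriv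

/-- Local geometric quantities do not depend on `ε` off the support of `h`; this lemma makes their
variations, and hence the boundary fluxes, compactly supported. -/
theorem dd_paramDir_eq_zero {Φ : ℝ × Pt → ℝ} (hΦ : DifferentiableAt ℝ Φ (0, x)) {c : ℝ}
    (hc : ∀ᶠ ε in nhds (0 : ℝ), Φ (ε, x) = c) : dd paramDir Φ (0, x) = 0 :=
  (hasDerivAt_slice hΦ).unique ((hasDerivAt_const 0 c).congr_of_eventuallyEq hc)

theorem christoffel_congr {g' : Tensor2} (hgg : g =ᶠ[nhds x] g') (k μ ν : Fin 4) :
    christoffel g k μ ν =ᶠ[nhds x] christoffel g' k μ ν := by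
  filter_upwards [hgg.eventuallyEq_nhds] with y hy
  have h1 : ∀ l i j, pd l (fun y => g y i j) y = pd l (fun y => g' y i j) y := fun l i j =>
    dd_congr (by filter_upwards [hy] with z hz; rw [hz]) _
  simp only [christoffel, ginv, hy.eq_of_nhds, h1]

theorem scal_congr {g' : Tensor2} (hgg : g =ᶠ[nhds x] g') : scal g x = scal g' x := by
  have h1 : ∀ l k i j, pd l (christoffel g k i j) x = pd l (christoffel g' k i j) x :=
    fun l k i j => dd_congr (christoffel_congr hgg k i j) _
  simp only [scal, ricci, ginv, hgg.eq_of_nhds, h1, (christoffel_congr hgg _ _ _).eq_of_nhds]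

theorem eventually_mem_famDom (hg : IsLorentzMetricOn Ω g) (hh : IsVariation Ω h) (hx : x ∈ Ω) :
    ∀ᶠ ε in nhds (0 : ℝ), (ε, x) ∈ famDom Ω g h :=
  ((smoothMetric_famMetric hg hh).isOpen.preimage (Continuous.prodMk_left x)).mem_nhds
    (mem_famDom_zero hg hx)

end MetricFamily

/-! ### First variation of the weighted Einstein–Hilbert integral. -/

section VariationFormula

open MeasureTheory

variable {Ω : Opens Pt} {g h : Tensor2} {ε : ℝ} {x : Pt} {F : Pt → ℝ}

theorem dd_paramDir_famMetric (hg : IsLorentzMetricOn Ω g) (hh : IsVariation Ω h) (hx : x ∈ Ω)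
    (i j : Fin 4) : dd paramDir (fun q => famMetric g h q i j) (0, x) = h x i j := by
  have S := smoothMetric_famMetric hg hh
  refine (hasDerivAt_slice (S.diff (S.smooth i j) (mem_famDom_zero hg hx))).unique ?_
  have := ((hasDerivAt_id (0 : ℝ)).mul_const (h x i j)).const_add (g x i j)
  rw [one_mul] at this
  exact this

theorem dd_paramDir_invM_eq_zero (hg : IsLorentzMetricOn Ω g) (hh : IsVariation Ω h) (hx : x ∈ Ω)
    (hxs : x ∉ varSupport h) (i j : Fin 4) :
    dd paramDir (invM (famMetric g h) i j) (0, x) = 0 := by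
  have S := smoothMetric_famMetric hg hh
  refine dd_paramDir_eq_zero (c := ginv g i j x) (S.diff (S.smooth_inv i j) (mem_famDom_zero hg hx))
    (Filter.Eventually.of_forall fun ε => ?_)
  simp only [invM, famMetric, ginv, (vary_eventuallyEq hh g ε hxs).eq_of_nhds]

theorem dd_paramDir_volM_eq_zero (hg : IsLorentzMetricOn Ω g) (hh : IsVariation Ω h) (hx : x ∈ Ω)
    (hxs : x ∉ varSupport h) :
    dd paramDir (fun q => Real.log (volM (famMetric g h) q)) (0, x) = 0 := by
  have S := smoothMetric_famMetric hg hh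
  refine dd_paramDir_eq_zero (c := Real.log (vol g x))
    (S.diff S.smooth_log_vol (mem_famDom_zero hg hx)) (Filter.Eventually.of_forall fun ε => ?_)
  simp only [volM, famMetric, vol, (vary_eventuallyEq hh g ε hxs).eq_of_nhds]

theorem dd_paramDir_densM_eq_zero (hg : IsLorentzMetricOn Ω g) (hh : IsVariation Ω h) (hx : x ∈ Ω)
    (hxs : x ∉ varSupport h) (i j : Fin 4) :
    dd paramDir (densM (famMetric g h) i j) (0, x) = 0 := by
  have S := smoothMetric_famMetric hg hh
  rw [S.dd_dens_eq (mem_famDom_zero hg hx), dd_paramDir_volM_eq_zero hg hh hx hxs,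
    dd_paramDir_invM_eq_zero hg hh hx hxs, zero_mul, add_zero, mul_zero]

theorem dd_paramDir_chr_eq_zero (hg : IsLorentzMetricOn Ω g) (hh : IsVariation Ω h) (hx : x ∈ Ω)
    (hxs : x ∉ varSupport h) (k i j : Fin 4) :
    dd paramDir (chr coordDir (famMetric g h) k i j) (0, x) = 0 := by
  have S := smoothMetric_famMetric hg hh
  refine dd_paramDir_eq_zero (c := christoffel g k i j x)
    (S.diff (S.smooth_chr k i j) (mem_famDom_zero hg hx)) ?_
  filter_upwards [eventually_mem_famDom hg hh hx] with ε hε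
  rw [← christoffel_vary hg hh hε,
    (christoffel_congr (vary_eventuallyEq hh g ε hxs) k i j).eq_of_nhds]

theorem contDiffOn_slice {D : Set (ℝ × Pt)} {Φ : ℝ × Pt → ℝ} {n : ℕ∞ω} (hΦ : ContDiffOn ℝ n Φ D)
    (hD : ∀ x ∈ Ω, (ε, x) ∈ D) : ContDiffOn ℝ n (fun x => Φ (ε, x)) Ω :=
  hΦ.comp (contDiff_prodMk_right ε).contDiffOn fun x hx => hD x hx

/-- The density `√(-g) R` of the family `g + ε h`. -/
noncomputable def famDensity (g h : Tensor2) (q : ℝ × Pt) : ℝ :=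
  volM (famMetric g h) q * scalM coordDir (famMetric g h) q

theorem contDiffOn_famDensity (hg : IsLorentzMetricOn Ω g) (hh : IsVariation Ω h) :
    ContDiffOn ℝ ∞ (famDensity g h) (famDom Ω g h) :=
  have S := smoothMetric_famMetric hg hh
  S.smooth_vol.mul S.smooth_scal

theorem famDensity_eq (hg : IsLorentzMetricOn Ω g) (hh : IsVariation Ω h)
    (hx : (ε, x) ∈ famDom Ω g h) :
    famDensity g h (ε, x) = vol (vary g h ε) x * scal (vary g h ε) x := by
  rw [scal_vary hg hh hx]
  rfl

theorem famDensity_eq_of_notMem (hg : IsLorentzMetricOn Ω g) (hh : IsVariation Ω h)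
    (hx : (ε, x) ∈ famDom Ω g h) (hxs : x ∉ varSupport h) :
    famDensity g h (ε, x) = vol g x * scal g x := by
  have hv := vary_eventuallyEq hh g ε hxs
  rw [famDensity_eq hg hh hx, scal_congr hv, vol, hv.eq_of_nhds, ← vol]

theorem continuousOn_dd_famDensity (hg : IsLorentzMetricOn Ω g) (hh : IsVariation Ω h) :
    ContinuousOn (fun x => dd paramDir (famDensity g h) (0, x)) Ω :=
  (contDiffOn_slice ((smoothMetric_famMetric hg hh).smooth_dd (contDiffOn_famDensity hg hh) paramDir)
    fun _ hx => mem_famDom_zero hg hx).continuousOn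

theorem dd_famDensity_eq_zero (hg : IsLorentzMetricOn Ω g) (hh : IsVariation Ω h) (hx : x ∈ Ω)
    (hxs : x ∉ varSupport h) : dd paramDir (famDensity g h) (0, x) = 0 := by
  refine dd_paramDir_eq_zero (c := vol g x * scal g x)
    ((smoothMetric_famMetric hg hh).diff (contDiffOn_famDensity hg hh) (mem_famDom_zero hg hx)) ?_
  filter_upwards [eventually_mem_famDom hg hh hx] with ε hε
    using famDensity_eq_of_notMem hg hh hε hxs

theorem integrableOn_mul_dd_famDensity (hg : IsLorentzMetricOn Ω g) (hh : IsVariation Ω h)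
    (hF : ContinuousOn F Ω) :
    IntegrableOn (fun x => F x * dd paramDir (famDensity g h) (0, x)) Ω :=
  integrableOn_of_eq_zero (isCompact_varSupport hh) (varSupport_subset hh)
    (hF.mul (continuousOn_dd_famDensity hg hh))
    fun x hx hxs => by rw [dd_famDensity_eq_zero hg hh hx hxs, mul_zero]

/-- The variation of `∫ F √(-g) R` for a fixed weight `F`. -/
theorem integral_mul_dd_famDensity (hg : IsLorentzMetricOn Ω g) (hh : IsVariation Ω h)
    (hF : ContDiffOn ℝ ∞ F Ω) :
    ∫ x in (Ω : Set Pt), F x * dd paramDir (famDensity g h) (0, x) =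
      ∫ x in (Ω : Set Pt), vol g x * ∑ μ, ∑ ν, deltaInv g h μ ν x *
        (einstein g μ ν x * F x + g x μ ν * box g F x - hess g μ ν F x) := by
  have S := smoothMetric_famMetric hg hh
  have hF' : ContDiffOn ℝ ∞ (fun q : ℝ × Pt => F q.2) (famDom Ω g h) :=
    hF.comp contDiff_snd.contDiffOn fun q hq => hq.1
  have hD : ∀ x ∈ Ω, ((0 : ℝ), x) ∈ famDom Ω g h := fun x hx => mem_famDom_zero hg hx
  -- The flux of `mul_dd_vol_mul_scal`. It is built from variations of `Γ` and of the densities, so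
  -- it vanishes off the support of `h` for any smooth weight `F`.
  let X : Fin 4 → ℝ × Pt → ℝ := fun k q =>
    F q.2 * palatiniField coordDir paramDir (famMetric g h) k q
      + gradField coordDir paramDir (famMetric g h) (fun q => F q.2) k q
  have hX : ∀ k, ContDiffOn ℝ ∞ (X k) (famDom Ω g h) := fun k =>
    (hF'.mul (S.smooth_palatiniField _ k)).add (S.smooth_gradField hF' _ k)
  have hX0 : ∀ k, ∀ x ∈ Ω, x ∉ varSupport h → X k (0, x) = 0 := by
    intro k x hx hxs
    simp only [X, palatiniField, gradField, dd_paramDir_chr_eq_zero hg hh hx hxs,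
      dd_paramDir_densM_eq_zero hg hh hx hxs, dd_paramDir_volM_eq_zero hg hh hx hxs, mul_zero,
      zero_mul, Finset.sum_const_zero, sub_zero, add_zero]
  have hXs : ∀ k, ContDiffOn ℝ ∞ (fun x => X k (0, x)) Ω := fun k => contDiffOn_slice (hX k) hD
  have hpd : ∀ k, ∀ x ∈ Ω, pd k (fun y => X k (0, y)) x = dd (coordDir k) (X k) (0, x) :=
    fun k x hx => pd_eq_dd_coordDir S.isOpen (hX k) (fun _ _ => rfl) (hD x hx) k
  have hpt : ∀ x ∈ (Ω : Set Pt), F x * dd paramDir (famDensity g h) (0, x) =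
      vol g x * (∑ μ, ∑ ν, deltaInv g h μ ν x *
        (einstein g μ ν x * F x + g x μ ν * box g F x - hess g μ ν F x))
      + ∑ k, pd k (fun y => X k (0, y)) x := by
    intro x hx
    have h1 := S.mul_dd_vol_mul_scal (e := coordDir) hF' (hD x hx) paramDir
    have hric := fun μ ν => ricci_vary hg hh (hD x hx) μ ν
    have hscal := scal_vary hg hh (hD x hx)
    have hbox := box_vary hg hh (hD x hx) hF
    have hhess := fun μ ν => hess_vary hg hh (hD x hx) hF μ ν
    have hmet : ∀ μ ν, famMetric g h (0, x) μ ν = g x μ ν := fun μ ν => by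
      simp only [famMetric, vary_zero]
    have hvol : volM (famMetric g h) (0, x) = vol g x := by
      simp only [volM, vol, famMetric, vary_zero]
    simp only [vary_zero] at hric hscal hbox hhess
    simp only [← hric, ← hscal, ← hbox, ← hhess, hmet, hvol, ← deltaInv_eq_dd hg hh hx] at h1
    simp only [hpd _ x hx, einstein]
    exact h1
  have hK := isCompact_varSupport hh
  have hKΩ := varSupport_subset hh
  have hdiv0 : ∀ k, ∀ x ∈ Ω, x ∉ varSupport h → pd k (fun y => X k (0, y)) x = 0 := by
    intro k x hx hxs
    have : (fun y => X k (0, y)) =ᶠ[nhds x] fun _ => 0 := by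
      filter_upwards [(Ω.isOpen.inter hK.isClosed.isOpen_compl).mem_nhds ⟨hx, hxs⟩] with y hy
        using hX0 k y hy.1 hy.2
    exact (dd_congr this _).trans (dd_const _ _)
  have hdivI : ∀ k, IntegrableOn (fun x => pd k (fun y => X k (0, y)) x) Ω := fun k =>
    integrableOn_of_eq_zero hK hKΩ (contDiffOn_dd Ω.isOpen (hXs k) _).continuousOn (hdiv0 k)
  have hI := integrableOn_mul_dd_famDensity hg hh hF.continuousOn
  have hsum : ∫ x in (Ω : Set Pt), ∑ k, pd k (fun y => X k (0, y)) x = 0 := by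
    rw [integral_finsetSum _ fun k _ => hdivI k]
    exact Finset.sum_eq_zero fun k _ =>
      integral_pd_eq_zero hK hKΩ ((hXs k).of_le (by simp)) (hX0 k) k
  have hsub := integral_sub hI (integrable_finsetSum Finset.univ fun k _ => hdivI k)
  rw [hsum, sub_zero] at hsub
  rw [← hsub]
  refine setIntegral_congr_fun Ω.isOpen.measurableSet fun x hx => ?_
  simp only [hpt x hx, add_sub_cancel_right]

/-- The parameter direction in `∂g⁻¹ = -g⁻¹(∂g)g⁻¹`. The map from `h` to `δg⁻¹` is pointwise
invertible, which the fundamental lemma relies on. -/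
theorem deltaInv_eq (hg : IsLorentzMetricOn Ω g) (hh : IsVariation Ω h) (hx : x ∈ Ω)
    (μ ν : Fin 4) : deltaInv g h μ ν x = -((g x)⁻¹ * h x * (g x)⁻¹) μ ν := by
  have S := smoothMetric_famMetric hg hh
  have h1 := S.dd_inv_matrix (mem_famDom_zero hg hx) paramDir
  have h2 : Matrix.of (fun i j => dd paramDir (fun q => famMetric g h q i j) (0, x)) = h x := by
    ext i j
    exact dd_paramDir_famMetric hg hh hx i j
  have h3 : famMetric g h (0, x) = g x := by simp only [famMetric, vary_zero]
  rw [h2, h3] at h1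
  rw [deltaInv_eq_dd hg hh hx]
  exact congrFun (congrFun h1 μ) ν

theorem deltaInv_symm (hg : IsLorentzMetricOn Ω g) (hh : IsVariation Ω h) (hx : x ∈ Ω)
    (μ ν : Fin 4) : deltaInv g h μ ν x = deltaInv g h ν μ x := by
  rw [deltaInv_eq_dd hg hh hx, deltaInv_eq_dd hg hh hx]
  exact (smoothMetric_famMetric hg hh).dd_inv_symm (mem_famDom_zero hg hx) _ _ _

theorem integrableOn_pairing (hg : IsLorentzMetricOn Ω g) (hh : IsVariation Ω h)
    {B : Fin 4 → Fin 4 → Pt → ℝ} (hB : ∀ μ ν, ContinuousOn (B μ ν) Ω) :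
    IntegrableOn (fun x => vol g x * ∑ μ, ∑ ν, B μ ν x * deltaInv g h μ ν x) Ω := by
  have S := smoothMetric_famMetric hg hh
  have hd : ∀ μ ν, ContinuousOn (deltaInv g h μ ν) Ω := fun μ ν =>
    (contDiffOn_slice (S.smooth_dd (S.smooth_inv μ ν) paramDir)
      fun x hx => mem_famDom_zero hg hx).continuousOn.congr fun x hx => deltaInv_eq_dd hg hh hx μ ν
  refine integrableOn_of_eq_zero (isCompact_varSupport hh) (varSupport_subset hh)
    (hg.smoothMetric.smooth_vol.continuousOn.mul (continuousOn_finsetSum _ fun μ _ =>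
      continuousOn_finsetSum _ fun ν _ => (hB μ ν).mul (hd μ ν))) fun x hx hxs => ?_
  simp only [deltaInv_eq_dd hg hh hx, dd_paramDir_invM_eq_zero hg hh hx hxs, mul_zero,
    Finset.sum_const_zero]

end VariationFormula

/-! ### Fundamental lemma for metric variations. -/

section FundamentalLemma

open MeasureTheory

variable {Ω : Opens Pt} {g : Tensor2}

/-- The variation `φ (e_a ⊗ e_b + e_b ⊗ e_a)`. -/
noncomputable def bumpVariation (φ : Pt → ℝ) (a b : Fin 4) : Tensor2 := fun x =>
  φ x • (Matrix.single a b 1 + Matrix.single b a 1)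

theorem isVariation_bumpVariation {φ : Pt → ℝ} (hφ : ContDiff ℝ ∞ φ) (hc : HasCompactSupport φ)
    (hs : tsupport φ ⊆ Ω) (a b : Fin 4) : IsVariation Ω (bumpVariation φ a b) := by
  refine ⟨fun x => ?_, fun μ ν => ?_⟩
  · rw [Matrix.IsSymm, bumpVariation, Matrix.transpose_smul, Matrix.transpose_add,
      Matrix.transpose_single, Matrix.transpose_single, add_comm]
  · set c : ℝ := (Matrix.single a b 1 + Matrix.single b a 1 : Matrix (Fin 4) (Fin 4) ℝ) μ ν
    have h1 : (fun x => bumpVariation φ a b x μ ν) = fun x => φ x * c := rfl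
    rw [h1]
    exact ⟨hφ.mul contDiff_const, hc.mul_right, (tsupport_mul_subset_left).trans hs⟩

/-- The **fundamental lemma of the calculus of variations** for variations of a metric. -/
theorem forall_eq_zero_of_integral_deltaInv_eq_zero (hg : IsLorentzMetricOn Ω g)
    {B : Fin 4 → Fin 4 → Pt → ℝ} (hB : ∀ μ ν, ContinuousOn (B μ ν) Ω)
    (hsymm : ∀ x ∈ Ω, ∀ μ ν, B μ ν x = B ν μ x)
    (h0 : ∀ h, IsVariation Ω h →
      ∫ x in (Ω : Set Pt), vol g x * ∑ μ, ∑ ν, B μ ν x * deltaInv g h μ ν x = 0) :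
    ∀ x ∈ Ω, ∀ μ ν, B μ ν x = 0 := by
  have S := hg.smoothMetric
  let M : Pt → Matrix (Fin 4) (Fin 4) ℝ := fun x => Matrix.of fun μ ν => B μ ν x
  -- `P` is `B` with both indices raised, so that `B_{μν} δg^{μν} = -P^{ab} h_{ab}` pairs with the
  -- freely chosen `h`.
  let P : Pt → Matrix (Fin 4) (Fin 4) ℝ := fun x => (g x)⁻¹ * M x * (g x)⁻¹
  have hPc : ∀ a b, ContinuousOn (fun x => P x a b) Ω := by
    intro a b
    simp only [P, Matrix.mul_apply]
    exact continuousOn_finsetSum _ fun i _ => ContinuousOn.mul (continuousOn_finsetSum _ fun j _ =>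
      (S.smooth_inv a j).continuousOn.mul (hB j i)) (S.smooth_inv i b).continuousOn
  have hPs : ∀ x ∈ Ω, ∀ a b, P x a b = P x b a := by
    intro x hx a b
    have h1 : ((g x)⁻¹).transpose = (g x)⁻¹ := by rw [Matrix.transpose_nonsing_inv, S.symm x hx]
    have h2 : (M x).transpose = M x := by
      ext μ ν
      exact hsymm x hx ν μ
    have h3 : (P x).transpose = P x := by
      simp only [P, Matrix.transpose_mul, h1, h2, Matrix.mul_assoc]
    exact (congrFun (congrFun h3 b) a)
  have hpair : ∀ h, IsVariation Ω h → ∀ x ∈ Ω, ∑ μ, ∑ ν, B μ ν x * deltaInv g h μ ν x =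
      -∑ a, ∑ b, P x a b * h x a b := by
    intro h hh x hx
    have h1 : ∀ A C : Matrix (Fin 4) (Fin 4) ℝ, ∑ μ, ∑ ν, A μ ν * C μ ν =
        (A.transpose * C).trace := by
      intro A C
      simp only [Matrix.trace, Matrix.diag, Matrix.mul_apply, Matrix.transpose_apply]
      exact Finset.sum_comm
    have hM : (M x).transpose = M x := by
      ext μ ν
      exact hsymm x hx ν μ
    have hP : (P x).transpose = P x := by
      ext μ ν
      exact hPs x hx ν μ
    have h2 := h1 (M x) (-((g x)⁻¹ * h x * (g x)⁻¹))
    have h3 := h1 (P x) (h x)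
    simp only [deltaInv_eq hg hh hx]
    rw [h3, hP]
    refine h2.trans ?_
    rw [hM, Matrix.mul_neg, Matrix.trace_neg, ← Matrix.mul_assoc, Matrix.trace_mul_comm,
      ← Matrix.mul_assoc, ← Matrix.mul_assoc]
  have hP0 : ∀ a b, ∀ x ∈ Ω, P x a b = 0 := by
    intro a b
    have hc : ContinuousOn (fun x => vol g x * P x a b) Ω :=
      S.smooth_vol.continuousOn.mul (hPc a b)
    have hae : ∀ᵐ x ∂(volume : Measure Pt), x ∈ (Ω : Set Pt) → vol g x * P x a b = 0 := by
      refine Ω.isOpen.ae_eq_zero_of_integral_contDiff_smul_eq_zero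
        (hc.locallyIntegrableOn Ω.isOpen.measurableSet) fun φ hφ hφc hφs => ?_
      have hh := isVariation_bumpVariation hφ hφc hφs a b
      have h1 := h0 _ hh
      -- The symmetric bump meets both `P^{ab}` and `P^{ba}`; for `a = b` the matrix unit is
      -- doubled, so the factor is `2` in every case.
      have h2 : ∀ x ∈ (Ω : Set Pt), vol g x * ∑ μ, ∑ ν, B μ ν x *
          deltaInv g (bumpVariation φ a b) μ ν x = -2 * (φ x • (vol g x * P x a b)) := by
        intro x hx
        have h3 : ∑ i, ∑ j, P x i j * bumpVariation φ a b x i j = φ x * (P x a b + P x b a) := by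
          simp only [bumpVariation, Matrix.smul_apply, Matrix.add_apply, Matrix.single_apply,
            smul_eq_mul, mul_add, Finset.sum_add_distrib, ite_and, mul_ite, mul_one, mul_zero,
            Finset.sum_ite_eq, Finset.mem_univ, if_true, Finset.sum_ite_irrel,
            Finset.sum_const_zero]
          ring
        rw [hpair _ hh x hx, h3, hPs x hx b a, smul_eq_mul]
        ring
      rw [setIntegral_congr_fun Ω.isOpen.measurableSet h2, integral_const_mul] at h1
      have h4 : ∫ x in (Ω : Set Pt), φ x • (vol g x * P x a b) = 0 := by linarith
      rw [← h4]
      refine (setIntegral_eq_integral_of_forall_compl_eq_zero fun x hx => ?_).symm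
      rw [image_eq_zero_of_notMem_tsupport fun hc => hx (hφs hc), zero_smul]
    -- Continuity upgrades vanishing almost everywhere to vanishing on all of `Ω`.
    have heq := Measure.eqOn_open_of_ae_eq (μ := (volume : Measure Pt))
      ((ae_restrict_iff' Ω.isOpen.measurableSet).2 hae) Ω.isOpen hc continuousOn_const
    intro x hx
    exact (mul_eq_zero.1 (heq hx)).resolve_left (S.vol_pos hx).ne'
  intro x hx μ ν
  have hPx : P x = 0 := by
    ext a b
    exact hP0 a b x hx
  have hM : M x = g x * P x * g x := by
    simp only [P]
    rw [Matrix.mul_assoc, Matrix.mul_assoc ((g x)⁻¹ * M x),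
      Matrix.nonsing_inv_mul _ (S.isUnit_det hx), Matrix.mul_one, ← Matrix.mul_assoc,
      Matrix.mul_nonsing_inv _ (S.isUnit_det hx), Matrix.one_mul]
  rw [hPx, Matrix.mul_zero, Matrix.zero_mul] at hM
  exact congrFun (congrFun hM μ) ν

end FundamentalLemma

/-! ### Regularity of the potentials and their wave equations. -/

section Potentials

open MeasureTheory

variable {Ω : Opens Pt} {g h : Tensor2} {Gr : Tensor2 → Kernel Ω} {f : ℝ → ℝ}

/-- Rules out the default value `0` of `toTest`. -/
theorem coe_toTest {K : Set Pt} {p : Pt → ℝ} (hK : IsCompact K) (hKΩ : K ⊆ Ω)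
    (hp : ContDiffOn ℝ ∞ p Ω) (h0 : ∀ x ∈ Ω, x ∉ K → p x = 0) :
    (toTest Ω p : Pt → ℝ) = (Ω : Set Pt).indicator p := by
  have ht := tsupport_indicator_subset hK h0
  have h : ContDiff ℝ ∞ ((Ω : Set Pt).indicator p) ∧
      HasCompactSupport ((Ω : Set Pt).indicator p) ∧
      tsupport ((Ω : Set Pt).indicator p) ⊆ Ω :=
    ⟨contDiff_indicator_of_eq_zero Ω.isOpen hK.isClosed hKΩ hp h0,
      hK.of_isClosed_subset (isClosed_tsupport _) ht, ht.trans hKΩ⟩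
  rw [toTest, dif_pos h]
  rfl

/-- `HasVariationAlong` asks for a source family over all real `ε`, while `g + εh` is controlled
only for small `ε`. Composing with `ρ` produces a global family that is unchanged near `0`. -/
theorem exists_smooth_cutoff {r : ℝ} (hr : 0 < r) : ∃ ρ : ℝ → ℝ, ContDiff ℝ ∞ ρ ∧
    (∀ ε, ρ ε ∈ Set.Ioo (-r) r) ∧ ∃ s, 0 < s ∧ ∀ ε ∈ Set.Ioo (-s) s, ρ ε = ε := by
  let b : ContDiffBump (0 : ℝ) := ⟨r / 4, r / 2, by linarith, by linarith⟩
  refine ⟨fun ε => b ε * ε, b.contDiff.mul contDiff_id, fun ε => ?_, r / 4,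
    by linarith, fun ε hε => ?_⟩
  · rw [Set.mem_Ioo, ← abs_lt, abs_mul, abs_of_nonneg b.nonneg]
    by_cases hε : |ε| < r
    · exact (mul_le_of_le_one_left (abs_nonneg ε) b.le_one).trans_lt hε
    · rw [b.zero_of_le_dist, zero_mul]
      · exact hr
      · rw [Real.dist_eq, sub_zero]
        exact (by linarith : r / 2 ≤ r).trans (not_lt.1 hε)
  · have h1 : b ε = 1 := b.one_of_mem_closedBall (by
      rw [mem_closedBall_zero_iff, Real.norm_eq_abs]
      exact (abs_lt.2 hε).le)
    simp only [h1, one_mul]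

/-- The set outside of which `√(-g) R` vanishes along a family of metrics. -/
theorem exists_compact_famDensity (hg : IsLorentzMetricOn Ω g) (hh : IsVariation Ω h)
    (hR : HasCompactSupportIn Ω (scal g)) : ∃ K : Set Pt, IsCompact K ∧ K ⊆ Ω ∧
      ∀ ε, ∀ x ∈ Ω, (ε, x) ∈ famDom Ω g h → x ∉ K → famDensity g h (ε, x) = 0 := by
  obtain ⟨K, hK, hKΩ, h0⟩ := hR
  refine ⟨K ∪ varSupport h, hK.union (isCompact_varSupport hh),
    Set.union_subset hKΩ (varSupport_subset hh), fun ε x hx hε hxK => ?_⟩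
  rw [famDensity_eq_of_notMem hg hh hε fun hxs => hxK (Or.inr hxs),
    h0 x hx fun hx' => hxK (Or.inl hx'), mul_zero]

/-- The potential `□⁻¹ R` of the family `g + ε h`, as a function of `(ε, x)`. -/
noncomputable def famPotU (Ω : Opens Pt) (g h : Tensor2) (Gr : Tensor2 → Kernel Ω)
    (q : ℝ × Pt) : ℝ :=
  potU Ω (vary g h q.1) (Gr (vary g h q.1)) q.2

/-- Collects what the adjoint argument needs of `U_ε`: joint `C¹` dependence to differentiate
integrals in `ε`, and smoothness in `x` with the wave equation at each fixed `ε` to apply Green's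
identity. -/
theorem exists_radius_famPotU (hg : IsLorentzMetricOn Ω g) (hh : IsVariation Ω h)
    (hGr : HasVariationAlong Ω Gr g h) (hR : HasCompactSupportIn Ω (scal g)) :
    ∃ r : ℝ, 0 < r ∧ (∀ ε ∈ Set.Ioo (-r) r, ∀ x ∈ Ω, (ε, x) ∈ famDom Ω g h) ∧
      ContDiffOn ℝ 1 (famPotU Ω g h Gr) (Set.Ioo (-r) r ×ˢ (Ω : Set Pt)) ∧
      (∀ ε ∈ Set.Ioo (-r) r, ContDiffOn ℝ ∞ (fun x => famPotU Ω g h Gr (ε, x)) Ω) ∧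
      ∀ ε ∈ Set.Ioo (-r) r, ∀ x ∈ Ω, vol (vary g h ε) x *
        box (vary g h ε) (fun x => famPotU Ω g h Gr (ε, x)) x = famDensity g h (ε, x) := by
  obtain ⟨r₁, hr₁, hgreen, hC1⟩ := hGr
  obtain ⟨r₂, hr₂, hdom⟩ := exists_radius_famDom hg hh
  obtain ⟨K, hK, hKΩ, hK0⟩ := exists_compact_famDensity hg hh hR
  obtain ⟨ρ, hρ, hρr, s, hs, hρs⟩ := exists_smooth_cutoff (lt_min hr₁ hr₂)
  have hρ₁ : ∀ ε, ρ ε ∈ Set.Ioo (-r₁) r₁ := fun ε =>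
    ⟨(neg_le_neg (min_le_left _ _)).trans_lt (hρr ε).1, (hρr ε).2.trans_le (min_le_left _ _)⟩
  have hρ₂ : ∀ ε, ρ ε ∈ Set.Ioo (-r₂) r₂ := fun ε =>
    ⟨(neg_le_neg (min_le_right _ _)).trans_lt (hρr ε).1, (hρr ε).2.trans_le (min_le_right _ _)⟩
  have hsub₁ : Set.Ioo (-s) s ⊆ Set.Ioo (-r₁) r₁ :=
    fun ε hε => by simpa only [hρs ε hε] using hρ₁ ε
  have hsub₂ : Set.Ioo (-s) s ⊆ Set.Ioo (-r₂) r₂ :=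
    fun ε hε => by simpa only [hρs ε hε] using hρ₂ ε
  have hsm : ∀ ε ∈ Set.Ioo (-r₂) r₂, ContDiffOn ℝ ∞ (fun x => famDensity g h (ε, x)) Ω :=
    fun ε hε => contDiffOn_slice (contDiffOn_famDensity hg hh) (hdom ε hε)
  have htest : ∀ ε ∈ Set.Ioo (-r₂) r₂,
      (toTest Ω (fun y => vol (vary g h ε) y * scal (vary g h ε) y) : Pt → ℝ) =
        (Ω : Set Pt).indicator fun x => famDensity g h (ε, x) := by
    intro ε hε
    have heq : Set.EqOn (fun y => vol (vary g h ε) y * scal (vary g h ε) y)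
        (fun x => famDensity g h (ε, x)) Ω := fun x hx =>
      (famDensity_eq hg hh (hdom ε hε x hx)).symm
    rw [coe_toTest hK hKΩ ((hsm ε hε).congr heq) fun x hx hxK =>
      (heq hx).trans (hK0 ε x hx (hdom ε hε x hx) hxK)]
    exact Set.indicator_congr heq
  let φ : ℝ → 𝓓(Ω, ℝ) := fun ε =>
    toTest Ω (fun y => vol (vary g h (ρ ε)) y * scal (vary g h (ρ ε)) y)
  have hφ : ∀ ε, (φ ε : Pt → ℝ) = (Ω : Set Pt).indicator fun x => famDensity g h (ρ ε, x) :=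
    fun ε => htest (ρ ε) (hρ₂ ε)
  have hφC : ContDiff ℝ ∞ fun q : ℝ × Pt => φ q.1 q.2 := by
    have h1 : (fun q : ℝ × Pt => φ q.1 q.2) = ((Set.univ : Set ℝ) ×ˢ (Ω : Set Pt)).indicator
        fun q => famDensity g h (ρ q.1, q.2) := by
      funext q
      rw [hφ]
      by_cases hq : q.2 ∈ (Ω : Set Pt)
      · rw [Set.indicator_of_mem hq, Set.indicator_of_mem (show q ∈ Set.univ ×ˢ (Ω : Set Pt) from
          ⟨trivial, hq⟩)]
      · rw [Set.indicator_of_notMem hq, Set.indicator_of_notMem fun hq' => hq hq'.2]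
    rw [h1]
    refine contDiff_indicator_of_eq_zero (C := Set.univ ×ˢ K) (isOpen_univ.prod Ω.isOpen)
      (isClosed_univ.prod hK.isClosed) (Set.prod_mono le_rfl hKΩ) ?_ ?_
    · exact (contDiffOn_famDensity hg hh).comp
        ((hρ.comp contDiff_fst).prodMk contDiff_snd).contDiffOn
        fun q hq => hdom _ (hρ₂ q.1) q.2 hq.2
    · intro q hq hqK
      exact hK0 _ q.2 hq.2 (hdom _ (hρ₂ q.1) q.2 hq.2) fun h => hqK ⟨trivial, h⟩
  have hφK : ∀ ε, tsupport (φ ε) ⊆ K := by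
    intro ε
    rw [hφ]
    exact tsupport_indicator_subset hK fun x hx hxK => hK0 _ x hx (hdom _ (hρ₂ ε) x hx) hxK
  have hU : ContDiffOn ℝ 1 (fun q : ℝ × Pt => Gr (vary g h q.1) q.2 (φ q.1))
      (Set.Ioo (-r₁) r₁ ×ˢ (Ω : Set Pt)) := hC1 φ hφC ⟨K, hK, hKΩ, hφK⟩
  refine ⟨s, hs, fun ε hε => hdom ε (hsub₂ hε), ?_, ?_, ?_⟩
  · refine (hU.mono (Set.prod_mono hsub₁ le_rfl)).congr fun q hq => ?_
    simp only [φ, hρs q.1 hq.1]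
    rfl
  · intro ε hε
    exact (hgreen ε (hsub₁ hε)).smooth
      (toTest Ω fun y => vol (vary g h ε) y * scal (vary g h ε) y)
  · intro ε hε x hx
    have h1 := (hgreen ε (hsub₁ hε)).green
      (toTest Ω (fun y => vol (vary g h ε) y * scal (vary g h ε) y)) x hx
    rw [htest ε (hsub₂ hε), Set.indicator_of_mem (show x ∈ (Ω : Set Pt) from hx)] at h1
    exact h1

/-- The potential `□⁻¹ (R f')` is smooth and solves its wave equation. -/
theorem potV_smooth_and_box (hg : IsLorentzMetricOn Ω g) (hf : ContDiff ℝ ∞ f)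
    {G : Kernel Ω} (hG : IsRetardedGreen Ω g G) (hU : ContDiffOn ℝ ∞ (potU Ω g G) Ω)
    (hR : HasCompactSupportIn Ω (scal g)) :
    ContDiffOn ℝ ∞ (potV Ω f g G) Ω ∧ ∀ x ∈ Ω, vol g x * box g (potV Ω f g G) x =
      vol g x * (scal g x * deriv f (potU Ω g G x)) := by
  obtain ⟨K, hK, hKΩ, h0⟩ := hR
  have S := hg.smoothMetric
  have hf' : ContDiff ℝ ∞ (deriv f) := ((contDiff_infty_iff_deriv (𝕜 := ℝ)).1 hf).2
  have hs : ContDiffOn ℝ ∞ (fun y => vol g y * (scal g y * deriv f (potU Ω g G y))) Ω :=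
    S.smooth_vol.mul ((S.smooth_scal (e := fun μ => Pi.single μ 1)).mul (hf'.comp_contDiffOn hU))
  have htest := coe_toTest hK hKΩ hs fun x hx hxK => by rw [h0 x hx hxK, zero_mul, mul_zero]
  refine ⟨hG.smooth _, fun x hx => ?_⟩
  have h1 := hG.green (toTest Ω fun y => vol g y * (scal g y * deriv f (potU Ω g G y))) x hx
  rw [htest, Set.indicator_of_mem (show x ∈ (Ω : Set Pt) from hx)] at h1
  exact h1

end Potentials

/-! ### The adjoint argument and the first variation of the action. -/

section ActionVariation

open MeasureTheory

variable {Ω : Opens Pt} {g h : Tensor2} {Gr : Tensor2 → Kernel Ω} {f : ℝ → ℝ} {ε : ℝ} {x : Pt}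

/-- The density `∂_σ (√(-g) g^{σλ} ∂_λ V)` of the family `g + ε h`. -/
noncomputable def famBoxDensity (g h : Tensor2) (V : Pt → ℝ) (q : ℝ × Pt) : ℝ :=
  ∑ σ, dd (coordDir σ) (fun q => ∑ l, densM (famMetric g h) σ l q *
    dd (coordDir l) (fun q => V q.2) q) q

theorem contDiffOn_famBoxDensity (hg : IsLorentzMetricOn Ω g) (hh : IsVariation Ω h) {V : Pt → ℝ}
    (hV : ContDiffOn ℝ ∞ V Ω) : ContDiffOn ℝ ∞ (famBoxDensity g h V) (famDom Ω g h) := by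
  have S := smoothMetric_famMetric hg hh
  have hV' : ContDiffOn ℝ ∞ (fun q : ℝ × Pt => V q.2) (famDom Ω g h) :=
    hV.comp contDiff_snd.contDiffOn fun q hq => hq.1
  exact ContDiffOn.sum fun σ _ => S.smooth_dd
    (ContDiffOn.sum fun l _ => (S.smooth_dens σ l).mul (S.smooth_dd hV' _)) _

theorem pd_eq_zero_of_eq_zero {K : Set Pt} (hK : IsCompact K) {V : Pt → ℝ}
    (hV0 : ∀ x ∈ Ω, x ∉ K → V x = 0) (hx : x ∈ Ω) (hxK : x ∉ K) (μ : Fin 4) : pd μ V x = 0 := by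
  have : V =ᶠ[nhds x] fun _ => 0 := by
    filter_upwards [(Ω.isOpen.inter hK.isClosed.isOpen_compl).mem_nhds ⟨hx, hxK⟩] with y hy
      using hV0 y hy.1 hy.2
  exact (dd_congr this _).trans (dd_const _ _)

theorem vol_mul_box_vary (hg : IsLorentzMetricOn Ω g) (hh : IsVariation Ω h)
    (hx : (ε, x) ∈ famDom Ω g h) (F : Pt → ℝ) :
    vol (vary g h ε) x * box (vary g h ε) F x =
      ∑ σ, pd σ (fun y => ∑ l, vol (vary g h ε) y * ginv (vary g h ε) σ l y * pd l F y) x := by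
  have hv : vol (vary g h ε) x ≠ 0 := ((smoothMetric_famMetric hg hh).vol_pos hx).ne'
  rw [box, ← mul_assoc, mul_one_div_cancel hv, one_mul]

/-- Moving the wave operator of `g + ε h` from a potential to a compactly supported function. -/
theorem integral_mul_vol_mul_box (hg : IsLorentzMetricOn Ω g) (hh : IsVariation Ω h)
    (hdom : ∀ x ∈ Ω, (ε, x) ∈ famDom Ω g h) {u V : Pt → ℝ} (hu : ContDiffOn ℝ ∞ u Ω)
    (hV : ContDiffOn ℝ ∞ V Ω) {K : Set Pt} (hK : IsCompact K) (hKΩ : K ⊆ Ω)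
    (hV0 : ∀ x ∈ Ω, x ∉ K → V x = 0) :
    ∫ x in (Ω : Set Pt), V x * (vol (vary g h ε) x * box (vary g h ε) u x) =
      ∫ x in (Ω : Set Pt), u x * famBoxDensity g h V (ε, x) := by
  have S := smoothMetric_famMetric hg hh
  have h1 := integral_mul_div_grad_comm
    (a := fun i j y => vol (vary g h ε) y * ginv (vary g h ε) i j y) hK hKΩ
    (fun i j => contDiffOn_slice (S.smooth_dens i j) hdom)
    (fun x hx i j => S.dens_symm (hdom x hx) i j) hu hV hV0
  have h2 : ∀ x ∈ (Ω : Set Pt), V x * (vol (vary g h ε) x * box (vary g h ε) u x) =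
      V x * ∑ i, pd i (fun y => ∑ j, vol (vary g h ε) y * ginv (vary g h ε) i j y * pd j u y) x :=
    fun x hx => by rw [vol_mul_box_vary hg hh (hdom x hx)]
  have h3 : ∀ x ∈ (Ω : Set Pt), u x * famBoxDensity g h V (ε, x) =
      u x * ∑ i, pd i (fun y => ∑ j, vol (vary g h ε) y * ginv (vary g h ε) i j y * pd j V y) x :=
    fun x hx => by rw [sum_pd_flux_vary hg hh (hdom x hx) hV, famBoxDensity]
  rw [setIntegral_congr_fun Ω.isOpen.measurableSet h2,
    setIntegral_congr_fun Ω.isOpen.measurableSet h3]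
  exact h1

/-- The variation of the wave operator, integrated by parts. -/
theorem integral_mul_dd_famBoxDensity (hg : IsLorentzMetricOn Ω g) (hh : IsVariation Ω h)
    {u V : Pt → ℝ} (hu : ContDiffOn ℝ ∞ u Ω) (hV : ContDiffOn ℝ ∞ V Ω) :
    IntegrableOn (fun x => u x * dd paramDir (famBoxDensity g h V) (0, x)) Ω ∧
    IntegrableOn (fun x => ∑ i, ∑ j,
      dd paramDir (densM (famMetric g h) i j) (0, x) * pd j V x * pd i u x) Ω ∧
    ∫ x in (Ω : Set Pt), u x * dd paramDir (famBoxDensity g h V) (0, x) =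
      -∫ x in (Ω : Set Pt), ∑ i, ∑ j,
        dd paramDir (densM (famMetric g h) i j) (0, x) * pd j V x * pd i u x := by
  have S := smoothMetric_famMetric hg hh
  have hD : ∀ x ∈ Ω, ((0 : ℝ), x) ∈ famDom Ω g h := fun x hx => mem_famDom_zero hg hx
  have hK := isCompact_varSupport hh
  have hKΩ := varSupport_subset hh
  have hV' : ContDiffOn ℝ ∞ (fun q : ℝ × Pt => V q.2) (famDom Ω g h) :=
    hV.comp contDiff_snd.contDiffOn fun q hq => hq.1
  have hpd : ∀ {φ : Pt → ℝ}, ContDiffOn ℝ ∞ φ Ω → ∀ i, ContDiffOn ℝ ∞ (pd i φ) Ω :=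
    fun hφ i => contDiffOn_dd Ω.isOpen hφ _
  have hdiff : ∀ {φ : Pt → ℝ}, ContDiffOn ℝ ∞ φ Ω → ∀ x ∈ Ω, DifferentiableAt ℝ φ x :=
    fun hφ x hx => ContDiffOn.differentiableAt_of_isOpen hφ Ω.isOpen (by simp) hx
  -- As `V` is independent of `ε`, the variation hits only the coefficients, and `δ(√(-g) □)V` is
  -- the divergence of `Z`. The support of `h` bounds that of `Z`, so no support condition on `u` or
  -- `V` is needed here.
  let Z : Fin 4 → Pt → ℝ := fun i x =>
    ∑ j, dd paramDir (densM (famMetric g h) i j) (0, x) * pd j V x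
  have hZ : ∀ i, ContDiffOn ℝ ∞ (Z i) Ω := fun i => ContDiffOn.sum fun j _ =>
    (contDiffOn_slice (S.smooth_dd (S.smooth_dens i j) paramDir) hD).mul (hpd hV j)
  have hZ0 : ∀ i, ∀ x ∈ Ω, x ∉ varSupport h → Z i x = 0 := fun i x hx hxs =>
    Finset.sum_eq_zero fun j _ => by rw [dd_paramDir_densM_eq_zero hg hh hx hxs, zero_mul]
  have hdB : ∀ x ∈ Ω, dd paramDir (famBoxDensity g h V) (0, x) = ∑ i, pd i (Z i) x := by
    intro x hx
    have hfl : ∀ σ, ContDiffOn ℝ ∞ (fun q => ∑ l, densM (famMetric g h) σ l q *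
        dd (coordDir l) (fun q => V q.2) q) (famDom Ω g h) := fun σ =>
      ContDiffOn.sum fun l _ => (S.smooth_dens σ l).mul (S.smooth_dd hV' _)
    have h1 : dd paramDir (famBoxDensity g h V) (0, x) = _ :=
      dd_sum (s := Finset.univ) (φ := fun σ => dd (coordDir σ) (fun q =>
        ∑ l, densM (famMetric g h) σ l q * dd (coordDir l) (fun q => V q.2) q))
        (fun σ _ => S.diff (S.smooth_dd (hfl σ) _) (hD x hx)) paramDir
    rw [h1]
    refine Finset.sum_congr rfl fun i _ => ?_
    rw [dd_comm S.isOpen (hfl i) (hD x hx)]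
    refine (pd_eq_dd_coordDir S.isOpen (S.smooth_dd (hfl i) paramDir) (fun y hy => ?_)
      (hD x hx) i).symm
    rw [dd_sum_mul (p := fun l => densM (famMetric g h) i l)
      (q := fun l => dd (coordDir l) (fun q => V q.2)) (fun l => S.diff (S.smooth_dens i l) hy)
      fun l => S.diff (S.smooth_dd hV' _) hy]
    refine Finset.sum_congr rfl fun j _ => ?_
    have h2 : dd paramDir (dd (coordDir j) fun q : ℝ × Pt => V q.2) (0, y) = 0 :=
      dd_paramDir_eq_zero (c := pd j V y) (S.diff (S.smooth_dd hV' _) hy) (by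
        filter_upwards [eventually_mem_famDom hg hh hy.1] with ε hε
          using (pd_eq_dd_coordDir S.isOpen hV' (fun _ _ => rfl) hε j).symm)
    rw [h2, mul_zero, add_zero, pd_eq_dd_coordDir S.isOpen hV' (fun _ _ => rfl) hy j]
  have hIa : IntegrableOn (fun x => u x * dd paramDir (famBoxDensity g h V) (0, x)) Ω := by
    refine integrableOn_of_eq_zero hK hKΩ (hu.continuousOn.mul (contDiffOn_slice
      (S.smooth_dd (contDiffOn_famBoxDensity hg hh hV) paramDir) hD).continuousOn)
      fun x hx hxs => ?_
    rw [hdB x hx, Finset.sum_eq_zero fun i _ => pd_eq_zero_of_eq_zero hK (hZ0 i) hx hxs i,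
      mul_zero]
  have hIb : IntegrableOn (fun x => ∑ i, ∑ j,
      dd paramDir (densM (famMetric g h) i j) (0, x) * pd j V x * pd i u x) Ω := by
    refine integrableOn_of_eq_zero hK hKΩ (ContDiffOn.continuousOn (n := ∞) (ContDiffOn.sum
      fun i _ => ContDiffOn.sum fun j _ => ((contDiffOn_slice
        (S.smooth_dd (S.smooth_dens i j) paramDir) hD).mul (hpd hV j)).mul (hpd hu i)))
      fun x hx hxs => ?_
    simp only [dd_paramDir_densM_eq_zero hg hh hx hxs, zero_mul, Finset.sum_const_zero]
  refine ⟨hIa, hIb, ?_⟩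
  have huZ : ∀ i, ContDiffOn ℝ ∞ (fun y => u y * Z i y) Ω := fun i => hu.mul (hZ i)
  have huZ0 : ∀ i, ∀ x ∈ Ω, x ∉ varSupport h → u x * Z i x = 0 := fun i x hx hxs => by
    rw [hZ0 i x hx hxs, mul_zero]
  have hpt : ∀ x ∈ (Ω : Set Pt), u x * dd paramDir (famBoxDensity g h V) (0, x)
      + (∑ i, ∑ j, dd paramDir (densM (famMetric g h) i j) (0, x) * pd j V x * pd i u x) =
      ∑ i, pd i (fun y => u y * Z i y) x := by
    intro x hx
    have h1 : ∀ i, pd i (fun y => u y * Z i y) x = pd i u x * Z i x + u x * pd i (Z i) x :=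
      fun i => dd_mul (hdiff hu x hx) (hdiff (hZ i) x hx) _
    simp only [h1, hdB x hx, Finset.sum_add_distrib, ← Finset.mul_sum, ← Finset.sum_mul]
    rw [add_comm]
    congr 1
    exact Finset.sum_congr rfl fun i _ => mul_comm _ _
  have hsum : ∫ x in (Ω : Set Pt), ∑ i, pd i (fun y => u y * Z i y) x = 0 := by
    rw [integral_finsetSum _ fun i _ => ?_]
    · exact Finset.sum_eq_zero fun i _ =>
        integral_pd_eq_zero hK hKΩ ((huZ i).of_le (by simp)) (huZ0 i) i
    · exact integrableOn_of_eq_zero hK hKΩ (hpd (huZ i) i).continuousOn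
        fun x hx hxs => pd_eq_zero_of_eq_zero hK (huZ0 i) hx hxs i
  rw [← setIntegral_congr_fun Ω.isOpen.measurableSet hpt, integral_add hIa hIb] at hsum
  exact eq_neg_of_add_eq_zero_left hsum

/-- The quadratic first-order term of the correction, paired with a symmetric variation. -/
theorem sum_kron_pairing {D N G : Fin 4 → Fin 4 → ℝ} {v u : Fin 4 → ℝ}
    (hD : ∀ i j, D i j = D j i) (hN : ∀ i j, N i j = N j i) :
    ∑ μ, ∑ ν, (∑ σ, ∑ l, ((1 / 2) * (kron μ σ * kron ν l + kron μ l * kron ν σ)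
        - (1 / 2) * G μ ν * N σ l) * v σ * u l) * D μ ν =
      ∑ i, ∑ j, ((-(1 / 2) * ∑ a, ∑ b, G a b * D a b) * N i j + D i j) * v j * u i := by
  set T : ℝ := ∑ i, ∑ j, N i j * v j * u i with hT
  have hT' : ∑ σ, ∑ l, N σ l * v σ * u l = T := by
    rw [hT, Finset.sum_comm]
    exact Finset.sum_congr rfl fun i _ => Finset.sum_congr rfl fun j _ => by rw [hN]
  have hk : ∀ μ ν, ∑ σ, ∑ l, kron μ σ * kron ν l * (v σ * u l) = v μ * u ν := by
    intro μ ν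
    simp [kron]
  have hk' : ∀ μ ν, ∑ σ, ∑ l, kron μ l * kron ν σ * (v σ * u l) = v ν * u μ := by
    intro μ ν
    simp [kron]
  have hin : ∀ μ ν, ∑ σ, ∑ l, ((1 / 2) * (kron μ σ * kron ν l + kron μ l * kron ν σ)
        - (1 / 2) * G μ ν * N σ l) * v σ * u l =
      (1 / 2) * (v μ * u ν + v ν * u μ) - (1 / 2) * G μ ν * T := by
    intro μ ν
    rw [← hT', ← hk μ ν, ← hk' μ ν]
    simp only [← Finset.sum_add_distrib, Finset.mul_sum, ← Finset.sum_sub_distrib]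
    exact Finset.sum_congr rfl fun _ _ => Finset.sum_congr rfl fun _ _ => by ring
  have hsw : ∑ μ, ∑ ν, v μ * u ν * D μ ν = ∑ μ, ∑ ν, v ν * u μ * D μ ν := by
    rw [Finset.sum_comm]
    exact Finset.sum_congr rfl fun i _ => Finset.sum_congr rfl fun j _ => by rw [hD]
  have hl : ∑ μ, ∑ ν, ((1 / 2) * (v μ * u ν + v ν * u μ) - (1 / 2) * G μ ν * T) * D μ ν =
      (1 / 2) * (∑ μ, ∑ ν, v μ * u ν * D μ ν + ∑ μ, ∑ ν, v ν * u μ * D μ ν)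
      - (1 / 2) * T * ∑ a, ∑ b, G a b * D a b := by
    simp only [← Finset.sum_add_distrib, Finset.mul_sum, ← Finset.sum_sub_distrib]
    exact Finset.sum_congr rfl fun _ _ => Finset.sum_congr rfl fun _ _ => by ring
  have hr : ∀ c : ℝ, ∑ i, ∑ j, (c * N i j + D i j) * v j * u i =
      c * T + ∑ μ, ∑ ν, v ν * u μ * D μ ν := by
    intro c
    rw [hT]
    simp only [← Finset.sum_add_distrib, Finset.mul_sum]
    exact Finset.sum_congr rfl fun _ _ => Finset.sum_congr rfl fun _ _ => by ring
  simp only [hin]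
  rw [hl, hr, hsw]
  ring

theorem pd_const_add (c : ℝ) (F : Pt → ℝ) (μ : Fin 4) : pd μ (fun y => c + F y) = pd μ F := by
  funext x
  simp only [pd, fderiv_const_add]

/-- The weight of `δ(√(-g) R)` is `1 + (f + V)`; its constant contributes to the Einstein tensor
term only. -/
theorem box_const_add (c : ℝ) (F : Pt → ℝ) : box g (fun y => c + F y) x = box g F x := by
  simp only [box, pd_const_add]

theorem hess_const_add (c : ℝ) (F : Pt → ℝ) (μ ν : Fin 4) :
    hess g μ ν (fun y => c + F y) x = hess g μ ν F x := by
  simp only [hess, pd_const_add]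

theorem famBoxDensity_eq_zero (hg : IsLorentzMetricOn Ω g) (hh : IsVariation Ω h)
    (hx : (ε, x) ∈ famDom Ω g h) {V : Pt → ℝ} (hV : ContDiffOn ℝ ∞ V Ω) {K : Set Pt}
    (hK : IsCompact K) (hV0 : ∀ x ∈ Ω, x ∉ K → V x = 0) (hxK : x ∉ K) :
    famBoxDensity g h V (ε, x) = 0 := by
  rw [famBoxDensity, ← sum_pd_flux_vary hg hh hx hV]
  refine Finset.sum_eq_zero fun σ _ => pd_eq_zero_of_eq_zero hK (fun y hy hyK => ?_) hx.1 hxK σ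
  exact Finset.sum_eq_zero fun l _ => by rw [pd_eq_zero_of_eq_zero hK hV0 hy hyK, mul_zero]

/-- The variation of the density of the gravitational action, in terms of the field equations. -/
theorem pairing_einstein_add_correction (hg : IsLorentzMetricOn Ω g) (hh : IsVariation Ω h)
    (G : Kernel Ω) (hx : x ∈ Ω) :
    vol g x * (∑ μ, ∑ ν, deltaInv g h μ ν x *
        (einstein g μ ν x * (1 + (f (potU Ω g G x) + potV Ω f g G x))
          + g x μ ν * box g (fun y => 1 + (f (potU Ω g G y) + potV Ω f g G y)) x
          - hess g μ ν (fun y => 1 + (f (potU Ω g G y) + potV Ω f g G y)) x))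
      + (∑ i, ∑ j, dd paramDir (densM (famMetric g h) i j) (0, x) * pd j (potV Ω f g G) x
          * pd i (potU Ω g G) x) =
    vol g x * ∑ μ, ∑ ν,
      (einstein g μ ν x + correction Ω f g G μ ν x) * deltaInv g h μ ν x := by
  have S := smoothMetric_famMetric hg hh
  have h0 := mem_famDom_zero (h := h) hg hx
  have hvol : volM (famMetric g h) (0, x) = vol g x := by
    simp only [volM, vol, famMetric, vary_zero]
  have hinv : ∀ i j, invM (famMetric g h) i j (0, x) = ginv g i j x := fun i j => by
    simp only [invM, ginv, famMetric, vary_zero]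
  have hmet : ∀ i j, famMetric g h (0, x) i j = g x i j := fun i j => by
    simp only [famMetric, vary_zero]
  have hdens : ∀ i j, dd paramDir (densM (famMetric g h) i j) (0, x) =
      vol g x * ((-(1 / 2) * ∑ a, ∑ b, g x a b * deltaInv g h a b x) * ginv g i j x
        + deltaInv g h i j x) := by
    intro i j
    rw [S.dd_dens_eq h0, S.dd_log_vol_inv h0]
    simp only [hvol, hinv, hmet, ← deltaInv_eq_dd hg hh hx]
  -- Symmetry of `δg^{ij}` accounts for the symmetrised product `δ_μ^{(σ} δ_ν^{λ)}`, and `δ√(-g)`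
  -- for the trace term.
  have hkron := sum_kron_pairing (D := fun i j => deltaInv g h i j x)
    (N := fun i j => ginv g i j x) (G := fun i j => g x i j)
    (v := fun i => pd i (potV Ω f g G) x) (u := fun i => pd i (potU Ω g G) x)
    (fun i j => deltaInv_symm hg hh hx i j) (fun i j => hg.smoothMetric.inv_symm hx i j)
  have hquad : ∑ i, ∑ j, dd paramDir (densM (famMetric g h) i j) (0, x) * pd j (potV Ω f g G) x
      * pd i (potU Ω g G) x = vol g x * ∑ i, ∑ j,
        ((-(1 / 2) * ∑ a, ∑ b, g x a b * deltaInv g h a b x) * ginv g i j x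
        + deltaInv g h i j x) * pd j (potV Ω f g G) x * pd i (potU Ω g G) x := by
    simp only [hdens, Finset.mul_sum (s := Finset.univ) (a := vol g x), mul_assoc]
  rw [hquad, ← hkron, ← mul_add, ← Finset.sum_add_distrib]
  congr 1
  refine Finset.sum_congr rfl fun μ _ => ?_
  rw [← Finset.sum_add_distrib]
  refine Finset.sum_congr rfl fun ν _ => ?_
  rw [box_const_add, hess_const_add]
  simp only [correction]
  ring

theorem contDiffOn_einstein (hg : IsLorentzMetricOn Ω g) (μ ν : Fin 4) :
    ContDiffOn ℝ ∞ (einstein g μ ν) Ω :=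
  have S := hg.smoothMetric
  (S.smooth_ric (e := fun μ => Pi.single μ 1) μ ν).sub
    ((contDiffOn_const.mul (S.smooth μ ν)).mul (S.smooth_scal (e := fun μ => Pi.single μ 1)))

theorem contDiffOn_box (hg : IsLorentzMetricOn Ω g) {F : Pt → ℝ} (hF : ContDiffOn ℝ ∞ F Ω) :
    ContDiffOn ℝ ∞ (box g F) Ω :=
  hg.smoothMetric.smooth_boxM (e := fun μ => Pi.single μ 1) hF

theorem contDiffOn_hess (hg : IsLorentzMetricOn Ω g) {F : Pt → ℝ} (hF : ContDiffOn ℝ ∞ F Ω)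
    (μ ν : Fin 4) : ContDiffOn ℝ ∞ (hess g μ ν F) Ω :=
  hg.smoothMetric.smooth_hessM (e := fun μ => Pi.single μ 1) hF μ ν

theorem contDiffOn_correction (hg : IsLorentzMetricOn Ω g) (hf : ContDiff ℝ ∞ f) {G : Kernel Ω}
    (hU : ContDiffOn ℝ ∞ (potU Ω g G) Ω) (hV : ContDiffOn ℝ ∞ (potV Ω f g G) Ω) (μ ν : Fin 4) :
    ContDiffOn ℝ ∞ (correction Ω f g G μ ν) Ω := by
  have S := hg.smoothMetric
  have hF : ContDiffOn ℝ ∞ (fun y => f (potU Ω g G y) + potV Ω f g G y) Ω :=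
    (hf.comp_contDiffOn hU).add hV
  exact ((((contDiffOn_einstein hg μ ν).mul hF).add ((S.smooth μ ν).mul (contDiffOn_box hg hF))).sub
    (contDiffOn_hess hg hF μ ν)).add (ContDiffOn.sum fun σ _ => ContDiffOn.sum fun l _ =>
      ((contDiffOn_const.sub ((contDiffOn_const.mul (S.smooth μ ν)).mul (S.smooth_inv σ l))).mul
        (contDiffOn_dd Ω.isOpen hV _)).mul (contDiffOn_dd Ω.isOpen hU _))

theorem einstein_symm (hg : IsLorentzMetricOn Ω g) (hx : x ∈ Ω) (μ ν : Fin 4) :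
    einstein g μ ν x = einstein g ν μ x := by
  have S := hg.smoothMetric
  have h : ricci g μ ν x = ricci g ν μ x := S.ric_symm (e := fun μ => Pi.single μ 1) hx μ ν
  rw [einstein, einstein, h, S.g_symm hx]

theorem correction_symm (hg : IsLorentzMetricOn Ω g) (hf : ContDiff ℝ ∞ f) {G : Kernel Ω}
    (hU : ContDiffOn ℝ ∞ (potU Ω g G) Ω) (hV : ContDiffOn ℝ ∞ (potV Ω f g G) Ω) (hx : x ∈ Ω)
    (μ ν : Fin 4) : correction Ω f g G μ ν x = correction Ω f g G ν μ x := by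
  have S := hg.smoothMetric
  have hF : ContDiffOn ℝ ∞ (fun y => f (potU Ω g G y) + potV Ω f g G y) Ω :=
    (hf.comp_contDiffOn hU).add hV
  have h : hess g μ ν (fun y => f (potU Ω g G y) + potV Ω f g G y) x =
      hess g ν μ (fun y => f (potU Ω g G y) + potV Ω f g G y) x :=
    S.hessM_symm (e := fun μ => Pi.single μ 1) hF hx μ ν
  simp only [correction]
  rw [h, einstein_symm hg hx μ ν, S.g_symm hx μ ν]
  congr 1
  exact Finset.sum_congr rfl fun σ _ => Finset.sum_congr rfl fun l _ => by ring

/-- The first variation of the gravitational action. -/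
theorem hasDerivAt_gravAction (hg : IsLorentzMetricOn Ω g) (hh : IsVariation Ω h)
    (hf : ContDiff ℝ ∞ f) (χ : ℝ) (hGr : HasVariationAlong Ω Gr g h)
    (hR : HasCompactSupportIn Ω (scal g)) (hV : HasCompactSupportIn Ω (potV Ω f g (Gr g))) :
    ContDiffOn ℝ ∞ (potU Ω g (Gr g)) Ω ∧ ContDiffOn ℝ ∞ (potV Ω f g (Gr g)) Ω ∧
    HasDerivAt (fun ε : ℝ => gravAction Ω χ f Gr (vary g h ε))
      (1 / (2 * χ) * ∫ x in (Ω : Set Pt), vol g x * ∑ μ, ∑ ν,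
        (einstein g μ ν x + correction Ω f g (Gr g) μ ν x) * deltaInv g h μ ν x) 0 := by
  have hG : IsRetardedGreen Ω g (Gr g) := by
    obtain ⟨r, hr, hgreen, -⟩ := hGr
    simpa only [vary_zero] using hgreen 0 ⟨by linarith, hr⟩
  obtain ⟨r, hr, hdom, hUC, hUs, hUbox⟩ := exists_radius_famPotU hg hh hGr hR
  obtain ⟨K, hK, hKΩ, hK0⟩ := exists_compact_famDensity hg hh hR
  obtain ⟨KV, hKV, hKVΩ, hV0⟩ := hV
  set O := Set.Ioo (-r) r ×ˢ (Ω : Set Pt) with hO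
  have hOo : IsOpen O := isOpen_Ioo.prod Ω.isOpen
  have hOD : O ⊆ famDom Ω g h := fun q hq => hdom q.1 hq.1 q.2 hq.2
  have h0r : (0 : ℝ) ∈ Set.Ioo (-r) r := ⟨by linarith, hr⟩
  have hO0 : ∀ x ∈ Ω, ((0 : ℝ), x) ∈ O := fun x hx => ⟨h0r, hx⟩
  set u := potU Ω g (Gr g) with hu
  set V := potV Ω f g (Gr g) with hVdef
  set Φ := famDensity g h with hΦ
  set B := famBoxDensity g h V with hB
  set U := famPotU Ω g h Gr with hUdef
  have hU0 : ∀ x, U (0, x) = u x := fun x => by simp only [hUdef, famPotU, vary_zero, hu]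
  have hus : ContDiffOn ℝ ∞ u Ω := (hUs 0 h0r).congr fun x _ => (hU0 x).symm
  obtain ⟨hVs, hVbox⟩ := potV_smooth_and_box hg hf hG hus hR
  refine ⟨hus, hVs, ?_⟩
  have hΦs : ContDiffOn ℝ ∞ Φ (famDom Ω g h) := contDiffOn_famDensity hg hh
  have hBs : ContDiffOn ℝ ∞ B (famDom Ω g h) := contDiffOn_famBoxDensity hg hh hVs
  have hΦ1 : ContDiffOn ℝ 1 Φ O := (hΦs.mono hOD).of_le (by simp)
  have hB1 : ContDiffOn ℝ 1 B O := (hBs.mono hOD).of_le (by simp)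
  have hV1 : ContDiffOn ℝ 1 (fun q : ℝ × Pt => V q.2) O :=
    (hVs.of_le (by simp)).comp contDiff_snd.contDiffOn fun q hq => hq.2
  have hfU1 : ContDiffOn ℝ 1 (fun q => f (U q)) O := (hf.of_le (by simp)).comp_contDiffOn hUC
  have hd1 : ∀ {X : ℝ × Pt → ℝ}, ContDiffOn ℝ 1 X O → ∀ x ∈ Ω, DifferentiableAt ℝ X (0, x) :=
    fun hX x hx => ContDiffOn.differentiableAt_of_isOpen hX hOo (by simp) (hO0 x hx)
  -- The equation `□V = R f'(U)` at `ε = 0`: it makes the coefficient of `δU` in the derivative of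
  -- `∫ U_ε √(-g_ε) □_ε V` equal to the one in the variation of the action.
  have hBV : ∀ x ∈ Ω, B (0, x) = Φ (0, x) * deriv f (u x) := by
    intro x hx
    have hd := hdom 0 h0r x hx
    have h1 := vol_mul_box_vary hg hh hd V
    rw [sum_pd_flux_vary hg hh hd hVs] at h1
    have h2 := famDensity_eq hg hh hd
    rw [vary_zero] at h1 h2
    rw [hB, famBoxDensity, ← h1, hVbox x hx, hΦ, h2, mul_assoc]
  -- the variation of the defining equation of the potential, tested against `V`
  have hfam : ∫ x in (Ω : Set Pt), dd paramDir (fun q => V q.2 * Φ q) (0, x) =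
      ∫ x in (Ω : Set Pt), dd paramDir (fun q => U q * B q) (0, x) := by
    have h1 := hasDerivAt_integral_family hr hKV hKVΩ (hV1.mul hΦ1)
      fun ε hε x hx hxK => by rw [hV0 x hx hxK, zero_mul]
    have h2 := hasDerivAt_integral_family hr hKV hKVΩ (hUC.mul hB1)
      fun ε hε x hx hxK => by
        rw [hB, famBoxDensity_eq_zero hg hh (hdom ε hε x hx) hVs hKV hV0 hxK, mul_zero]
    refine h1.unique (h2.congr_of_eventuallyEq ?_)
    filter_upwards [Ioo_mem_nhds h0r.1 h0r.2] with ε hε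
    have h3 := integral_mul_vol_mul_box hg hh (hdom ε hε) (hUs ε hε) hVs hKV hKVΩ hV0
    rw [← h3]
    exact setIntegral_congr_fun Ω.isOpen.measurableSet fun x hx => by
      simp only [hUbox ε hε x hx]
      rfl
  have hVΦ : ∀ x ∈ (Ω : Set Pt), dd paramDir (fun q => V q.2 * Φ q) (0, x) =
      V x * dd paramDir Φ (0, x) := by
    intro x hx
    rw [dd_mul (hd1 hV1 x hx) (hd1 hΦ1 x hx), dd_paramDir_eq_zero (c := V x) (hd1 hV1 x hx)
      (Filter.Eventually.of_forall fun _ => rfl), zero_mul, zero_add]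
  have hUB : ∀ x ∈ (Ω : Set Pt), dd paramDir (fun q => U q * B q) (0, x) =
      Φ (0, x) * (deriv f (u x) * dd paramDir U (0, x)) + u x * dd paramDir B (0, x) := by
    intro x hx
    rw [dd_mul (hd1 hUC x hx) (hd1 hB1 x hx), hBV x hx, hU0]
    ring
  obtain ⟨hIB, hIQ, hQ⟩ := integral_mul_dd_famBoxDensity hg hh hus hVs
  -- Compact support comes from the factor `√(-g) R`; `δU` itself may spread over `Ω`.
  have hIU : IntegrableOn (fun x => Φ (0, x) * (deriv f (u x) * dd paramDir U (0, x))) Ω := by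
    have hf' : ContDiff ℝ ∞ (deriv f) := ((contDiff_infty_iff_deriv (𝕜 := ℝ)).1 hf).2
    refine integrableOn_of_eq_zero hK hKΩ ?_ fun x hx hxK => by
      rw [hK0 0 x hx (hdom 0 h0r x hx) hxK, zero_mul]
    exact (contDiffOn_slice hΦs (hdom 0 h0r)).continuousOn.mul
      ((hf'.comp_contDiffOn hus).continuousOn.mul ((continuousOn_dd hOo hUC paramDir).comp
        (Continuous.prodMk_right (0 : ℝ)).continuousOn fun x hx => hO0 x hx))
  have hIV := integrableOn_mul_dd_famDensity hg hh hVs.continuousOn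
  rw [setIntegral_congr_fun Ω.isOpen.measurableSet hVΦ,
    setIntegral_congr_fun Ω.isOpen.measurableSet hUB, integral_add hIU hIB, hQ] at hfam
  -- the variation of the action
  have hact := hasDerivAt_integral_family (Ψ := fun q => Φ q * (1 + f (U q))) hr hK hKΩ
    (hΦ1.mul (contDiffOn_const.add hfU1)) fun ε hε x hx hxK => by
      simp only [hK0 ε x hx (hdom ε hε x hx) hxK, zero_mul]
  have hΨ : ∀ x ∈ (Ω : Set Pt), dd paramDir (fun q => Φ q * (1 + f (U q))) (0, x) =
      (1 + f (u x)) * dd paramDir Φ (0, x)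
        + Φ (0, x) * (deriv f (u x) * dd paramDir U (0, x)) := by
    intro x hx
    rw [dd_mul (ψ := fun q => 1 + f (U q)) (hd1 hΦ1 x hx)
        ((differentiableAt_const _).add (hd1 hfU1 x hx)),
      dd_add (differentiableAt_const _) (hd1 hfU1 x hx), dd_const, zero_add,
      dd_comp (hf.differentiable (by simp) _) (hd1 hUC x hx), hU0]
    ring
  have hF1 : ContDiffOn ℝ ∞ (fun y => 1 + (f (u y) + V y)) Ω :=
    contDiffOn_const.add ((hf.comp_contDiffOn hus).add hVs)
  have hIf := integrableOn_mul_dd_famDensity hg hh (F := fun y => 1 + f (u y))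
    (contDiffOn_const.add (hf.comp_contDiffOn hus)).continuousOn
  have hgeom := integral_mul_dd_famDensity hg hh hF1
  have hsplit : ∫ x in (Ω : Set Pt), (1 + (f (u x) + V x)) * dd paramDir Φ (0, x) =
      (∫ x in (Ω : Set Pt), (1 + f (u x)) * dd paramDir Φ (0, x))
        + ∫ x in (Ω : Set Pt), V x * dd paramDir Φ (0, x) := by
    rw [← integral_add hIf hIV]
    exact integral_congr_ae (Filter.Eventually.of_forall fun x => by
      simp only [hΦ]
      ring)
  have hE : ∀ μ ν, ContinuousOn (fun x => einstein g μ ν x * (1 + (f (u x) + V x))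
      + g x μ ν * box g (fun y => 1 + (f (u y) + V y)) x
      - hess g μ ν (fun y => 1 + (f (u y) + V y)) x) Ω := by
    intro μ ν
    exact ((((contDiffOn_einstein hg μ ν).mul hF1).add ((hg.smoothMetric.smooth μ ν).mul
      (contDiffOn_box hg hF1))).sub (contDiffOn_hess hg hF1 μ ν)).continuousOn
  have hIE : IntegrableOn (fun x => vol g x * ∑ μ, ∑ ν, deltaInv g h μ ν x *
      (einstein g μ ν x * (1 + (f (u x) + V x))
      + g x μ ν * box g (fun y => 1 + (f (u y) + V y)) x
      - hess g μ ν (fun y => 1 + (f (u y) + V y)) x)) Ω := by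
    simpa only [mul_comm] using integrableOn_pairing hg hh hE
  -- By `hfam` the integral containing `δU` is `∫ V δ(√(-g) R)` plus the quadratic term; the former
  -- joins `1 + f(U)` to form the weight in `hgeom`.
  have hval : ∫ x in (Ω : Set Pt), dd paramDir (fun q => Φ q * (1 + f (U q))) (0, x) =
      ∫ x in (Ω : Set Pt), vol g x * ∑ μ, ∑ ν,
        (einstein g μ ν x + correction Ω f g (Gr g) μ ν x) * deltaInv g h μ ν x := by
    rw [setIntegral_congr_fun Ω.isOpen.measurableSet hΨ, integral_add hIf hIU,
      ← setIntegral_congr_fun Ω.isOpen.measurableSet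
        fun x hx => pairing_einstein_add_correction (f := f) hg hh (Gr g) hx,
      integral_add hIE hIQ, ← hgeom, hsplit]
    linarith
  rw [← hval]
  refine (hact.const_mul (1 / (2 * χ))).congr_of_eventuallyEq ?_
  filter_upwards [Ioo_mem_nhds h0r.1 h0r.2] with ε hε
  rw [gravAction]
  congr 1
  refine setIntegral_congr_fun Ω.isOpen.measurableSet fun x hx => ?_
  simp only [hΦ, famDensity_eq hg hh (hdom ε hε x hx), hUdef, famPotU]
  ring

end ActionVariation

/-! ### From the first variation to the field equations. -/

section FieldEquations

open MeasureTheory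

variable {Ω : Opens Pt} {g : Tensor2}

theorem isVariation_zero : IsVariation Ω 0 := by
  refine ⟨fun x => Matrix.transpose_zero, fun μ ν => ⟨contDiff_const, HasCompactSupport.zero, ?_⟩⟩
  change tsupport (0 : Pt → ℝ) ⊆ _
  rw [tsupport_zero]
  exact Set.empty_subset _

/-- A functional whose variation is the pairing with a symmetric tensor field is stationary if and
only if the field vanishes. -/
theorem isStationary_iff_forall_eq_zero (hg : IsLorentzMetricOn Ω g) {S : Tensor2 → ℝ}
    {B : Fin 4 → Fin 4 → Pt → ℝ} (hB : ∀ μ ν, ContinuousOn (B μ ν) Ω)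
    (hsymm : ∀ x ∈ Ω, ∀ μ ν, B μ ν x = B ν μ x)
    (hS : ∀ h, IsVariation Ω h → HasDerivAt (fun ε : ℝ => S (vary g h ε))
      (∫ x in (Ω : Set Pt), vol g x * ∑ μ, ∑ ν, B μ ν x * deltaInv g h μ ν x) 0) :
    IsStationary Ω S g ↔ ∀ x ∈ Ω, ∀ μ ν, B μ ν x = 0 := by
  refine ⟨fun hst => forall_eq_zero_of_integral_deltaInv_eq_zero hg hB hsymm fun h hh =>
    (hS h hh).unique (hst h hh), fun h0 h hh => ?_⟩
  have h1 := hS h hh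
  rwa [setIntegral_congr_fun Ω.isOpen.measurableSet (g := fun _ => (0 : ℝ)) fun x hx => by
    simp only [h0 x hx, zero_mul, Finset.sum_const_zero, mul_zero], integral_zero] at h1

theorem const_mul_integral_pairing (c : ℝ) (B : Fin 4 → Fin 4 → Pt → ℝ) (h : Tensor2) :
    c * ∫ x in (Ω : Set Pt), vol g x * ∑ μ, ∑ ν, B μ ν x * deltaInv g h μ ν x =
      ∫ x in (Ω : Set Pt), vol g x * ∑ μ, ∑ ν, c * B μ ν x * deltaInv g h μ ν x := by
  rw [← integral_const_mul]
  refine integral_congr_ae (Filter.Eventually.of_forall fun x => ?_)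
  simp only [Finset.mul_sum]
  exact Finset.sum_congr rfl fun _ _ => Finset.sum_congr rfl fun _ _ => by ring

theorem isStationary_iff_vacuum (hg : IsLorentzMetricOn Ω g) {S : Tensor2 → ℝ} {χ : ℝ} (hχ : χ ≠ 0)
    {E : Fin 4 → Fin 4 → Pt → ℝ} (hE : ∀ μ ν, ContinuousOn (E μ ν) Ω)
    (hsymm : ∀ x ∈ Ω, ∀ μ ν, E μ ν x = E ν μ x)
    (hS : ∀ h, IsVariation Ω h → HasDerivAt (fun ε : ℝ => S (vary g h ε))
      (1 / (2 * χ) * ∫ x in (Ω : Set Pt), vol g x * ∑ μ, ∑ ν, E μ ν x * deltaInv g h μ ν x) 0) :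
    IsStationary Ω S g ↔ ∀ x ∈ Ω, ∀ μ ν, E μ ν x = 0 := by
  rw [isStationary_iff_forall_eq_zero hg (B := fun μ ν x => 1 / (2 * χ) * E μ ν x)
    (fun μ ν => continuousOn_const.mul (hE μ ν))
    (fun x hx μ ν => congrArg _ (hsymm x hx μ ν)) fun h hh => by
      rw [← const_mul_integral_pairing]
      exact hS h hh]
  refine forall₄_congr fun x hx μ ν => ?_
  rw [mul_eq_zero, or_iff_right (by simpa using hχ)]

/-- The total variation pairs `δg^{μν}` with `(E/χ - T)/2`; adding the two pairings under one
integral uses the compact support of `δg^{μν}`. -/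
theorem isStationary_add_iff_matter (hg : IsLorentzMetricOn Ω g) {S L : Tensor2 → ℝ} {χ : ℝ}
    (hχ : χ ≠ 0) {E T : Fin 4 → Fin 4 → Pt → ℝ} (hE : ∀ μ ν, ContinuousOn (E μ ν) Ω)
    (hEs : ∀ x ∈ Ω, ∀ μ ν, E μ ν x = E ν μ x) (hT : ∀ μ ν, ContinuousOn (T μ ν) Ω)
    (hTs : ∀ x ∈ Ω, ∀ μ ν, T μ ν x = T ν μ x)
    (hS : ∀ h, IsVariation Ω h → HasDerivAt (fun ε : ℝ => S (vary g h ε))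
      (1 / (2 * χ) * ∫ x in (Ω : Set Pt), vol g x * ∑ μ, ∑ ν, E μ ν x * deltaInv g h μ ν x) 0)
    (hL : ∀ h, IsVariation Ω h → HasDerivAt (fun ε : ℝ => L (vary g h ε))
      (-(1 / 2) * ∫ x in (Ω : Set Pt), vol g x * ∑ μ, ∑ ν, T μ ν x * deltaInv g h μ ν x) 0) :
    IsStationary Ω (fun g' => S g' + L g') g ↔ ∀ x ∈ Ω, ∀ μ ν, E μ ν x = χ * T μ ν x := by
  rw [isStationary_iff_forall_eq_zero hg
    (B := fun μ ν x => 1 / (2 * χ) * E μ ν x + -(1 / 2) * T μ ν x)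
    (fun μ ν => (continuousOn_const.mul (hE μ ν)).add (continuousOn_const.mul (hT μ ν)))
    (fun x hx μ ν => by rw [hEs x hx, hTs x hx]) fun h hh => ?_]
  · refine forall₄_congr fun x hx μ ν => ⟨fun h0 => ?_, fun h0 => ?_⟩
    · field_simp at h0
      linarith
    · rw [h0]
      field_simp
      ring
  · have hsum := (hS h hh).add (hL h hh)
    rw [const_mul_integral_pairing, const_mul_integral_pairing, ← integral_add
      (integrableOn_pairing hg hh (B := fun μ ν x => 1 / (2 * χ) * E μ ν x)
        fun μ ν => continuousOn_const.mul (hE μ ν))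
      (integrableOn_pairing hg hh (B := fun μ ν x => -(1 / 2) * T μ ν x)
        fun μ ν => continuousOn_const.mul (hT μ ν))] at hsum
    refine hsum.congr_deriv (integral_congr_ae (Filter.Eventually.of_forall fun x => ?_))
    simp only [← mul_add, ← Finset.sum_add_distrib, ← add_mul]

end FieldEquations

end NonlocalGravity

theorem mainTheorem4 (Ω : TopologicalSpace.Opens NonlocalGravity.Pt) (χ : ℝ) (hχ : χ ≠ 0)
    (f : ℝ → ℝ) (hf : AnalyticOnNhd ℝ f Set.univ)
    (g : NonlocalGravity.Tensor2) (hg : NonlocalGravity.IsLorentzMetricOn Ω g)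
    (Gr : NonlocalGravity.Tensor2 → NonlocalGravity.Kernel Ω)
    (hGr : ∀ h, NonlocalGravity.IsVariation Ω h → NonlocalGravity.HasVariationAlong Ω Gr g h)
    (hR : NonlocalGravity.HasCompactSupportIn Ω (NonlocalGravity.scal g))
    (hV : NonlocalGravity.HasCompactSupportIn Ω (NonlocalGravity.potV Ω f g (Gr g))) :
    (NonlocalGravity.IsStationary Ω (NonlocalGravity.gravAction Ω χ f Gr) g ↔
      ∀ x ∈ Ω, ∀ μ ν,
        NonlocalGravity.einstein g μ ν x + NonlocalGravity.correction Ω f g (Gr g) μ ν x = 0) ∧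
    ∀ (Lm : NonlocalGravity.Tensor2 → NonlocalGravity.Pt → ℝ) (T : NonlocalGravity.Tensor2),
      NonlocalGravity.IsEnergyMomentum Ω Lm g T →
      (NonlocalGravity.IsStationary Ω
          (fun g' => NonlocalGravity.gravAction Ω χ f Gr g' +
            NonlocalGravity.matterAction Ω Lm g') g ↔
        ∀ x ∈ Ω, ∀ μ ν,
          NonlocalGravity.einstein g μ ν x + NonlocalGravity.correction Ω f g (Gr g) μ ν x =
            χ * T x μ ν) := by
  have hfs : ContDiff ℝ ∞ f := contDiffOn_univ.1 hf.contDiffOn_of_completeSpace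
  -- Smoothness of the potentials concerns `g` alone, so the zero variation suffices to extract it.
  obtain ⟨hU, hVs, -⟩ := NonlocalGravity.hasDerivAt_gravAction hg NonlocalGravity.isVariation_zero
    hfs χ (hGr 0 NonlocalGravity.isVariation_zero) hR hV
  have hEc := fun μ ν => ((NonlocalGravity.contDiffOn_einstein hg μ ν).add
    (NonlocalGravity.contDiffOn_correction hg hfs hU hVs μ ν)).continuousOn
  have hEs := fun x (hx : x ∈ Ω) μ ν => congrArg₂ (· + ·) (NonlocalGravity.einstein_symm hg hx μ ν)
    (NonlocalGravity.correction_symm hg hfs hU hVs hx μ ν)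
  have hgrav := fun h hh =>
    (NonlocalGravity.hasDerivAt_gravAction hg hh hfs χ (hGr h hh) hR hV).2.2
  exact ⟨NonlocalGravity.isStationary_iff_vacuum hg hχ hEc hEs hgrav, fun Lm T hT =>
    NonlocalGravity.isStationary_add_iff_matter hg hχ hEc hEs hT.cont
      (fun x hx μ ν => (hT.symm x hx).apply ν μ) hgrav hT.variation⟩
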